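/- \textbf{Setting.} Let $D$ be a finite set (the dictionary) and $S = D \cup \{[_i, ]_i : i \in \mathbb{N}\}$. An \emph{expression} is a circular permutation of a sequence $[_i\, a$, where $i \in \mathbb{N}$ and $a$ is a nonempty finite sequence of elements of $D \cup \{]_j : j \ge 1\}$ that is not reduced to a single symbol $]_j$. Let $\mathcal{E}$ be the set of expressions, and $\mathcal{E}_g \subset \mathcal{E}$ the set of expressions whose opening bracket is $[_0$. For $e \in \mathcal{E}$ let $\delta(e)$ be the sum of the unit masses at the circular permutations of $e$. A \emph{toric grammar} is a positive measure $\mathcal{G}$ with finite support on $\mathcal{E}$, invariant under circular permutations of expressions; $\mathfrak{F}$ is the set of toric grammars. A \emph{text} is a toric grammar with integer weights supported by circular permutations of sequences $[_0\, w_1 \cdots w_k$, $k \ge 1$, $w_j \in D$; $\mathfrak{T}$ is the set of texts. For $\mathcal{G}, \mathcal{R} \in \mathfrak{F}$ let \[ \alpha(\mathcal{G}) = \{\mathcal{G}' \in \mathfrak{F} : \mathcal{G}' = \mathcal{G} - \delta(a\,]_i) - \delta([_i\, b) + \delta(ab)\}, \] \[ \beta_n(\mathcal{G},\mathcal{R})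 = \{\mathcal{G}' \in \mathfrak{F} : \mathcal{G}' = \mathcal{G} - \delta(ab) + \delta(a\,]_i) + \delta([_i\, b),\ ab \in \mathcal{E}_g,\ \mathcal{R}([_i\, b) > 0\}, \] where $a, b$ range over finite sequences of symbols and $i$ over $\mathbb{N}$ with $ab$, $a\,]_i$, $[_i\, b \in \mathcal{E}$. A \emph{parsing process} with reference grammar $\mathcal{R}$ is a time homogeneous Markov chain $(S_t)$ on $\mathfrak{F}$ stopped at $\tau = \inf\{t : \beta_n(S_t,\mathcal{R}) = \varnothing\}$ such that, as long as it is not stopped, $P(S_{t+1} = \mathcal{G}' \mid S_t = \mathcal{G}) > 0 \iff \mathcal{G}' \in \beta_n(\mathcal{G},\mathcal{R})$. A \emph{production process} is a time homogeneous Markov chain $(P_t)$ on $\mathfrak{F}$ stopped at $\sigma = \inf\{t : \alpha(P_t) = \varnothing\}$ such that, as long as it is not stopped, $P(P_{t+1} = \mathcal{G}' \mid P_t = \mathcal{G}) > 0 \iff \mathcal{G}' \in \alpha(\mathcal{G})$. The corresponding \emph{split and merge process} is a Markov chain $(G_t)_{t \in \mathbb{N}}$ on $\mathfrak{F}$, with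 $G_0 \in \mathfrak{T}$ almost surely and transition probabilities \[ P(G_{2t+1} = \mathcal{G}' \mid G_{2t} = \mathcal{G}) = P(S_\tau = \mathcal{G}' \mid S_0 = \mathcal{G}), \qquad P(G_{2t+2} = \mathcal{G}' \mid G_{2t+1} = \mathcal{G}) = P(P_\sigma = \mathcal{G}' \mid P_0 = \mathcal{G},\, P_\sigma \in \mathfrak{T}). \] Below, conditional probabilities given the state of $G_t$ denote these transition probabilities and their compositions, also for states that the initial distribution does not charge. Let $\mathfrak{F}_1 = \{\mathcal{G} \in \mathfrak{F} : P(G_{2t+1} = \mathcal{G}) > 0 \text{ for some } t \in \mathbb{N}\}$. \textbf{Proposition (weak reversibility of the split and merge process).} Let $\mathcal{R} \in \mathfrak{F}$, and let $(G_t)$ be the split and merge process built from a parsing process with reference grammar $\mathcal{R}$ and a production process. Then: \begin{enumerate} \item For all $\mathcal{T} \in \mathfrak{T}$ and $\mathcal{G} \in \mathfrak{F}_1$, \[ P(G_1 = \mathcal{G} \mid G_0 = \mathcal{T}) > 0 \iff P(G_2 = \mathcal{T} \mid G_1 = \mathcal{G}) > 0. \] \item For every $\mathcal{G} \in \mathfrak{F}_1$,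 $P(P_\sigma \in \mathfrak{T} \mid P_0 = \mathcal{G}) > 0$; and $q_{\mathcal{R}}(\mathcal{T},\mathcal{T}') = P(G_2 = \mathcal{T}' \mid G_0 = \mathcal{T})$ is a well defined Markov kernel on $\mathfrak{T}$: $\sum_{\mathcal{T}' \in \mathfrak{T}} q_{\mathcal{R}}(\mathcal{T},\mathcal{T}') = 1$ for all $\mathcal{T} \in \mathfrak{T}$. \item For all $\mathcal{T}, \mathcal{T}' \in \mathfrak{T}$ and all $\mathcal{G}, \mathcal{G}' \in \mathfrak{F}_1$, \[ P(G_2 = \mathcal{T}' \mid G_0 = \mathcal{T}) > 0 \iff P(G_2 = \mathcal{T} \mid G_0 = \mathcal{T}') > 0, \] \[ P(G_3 = \mathcal{G}' \mid G_1 = \mathcal{G}) > 0 \iff P(G_3 = \mathcal{G} \mid G_1 = \mathcal{G}') > 0. \] \item $(G_{2t})_{t \in \mathbb{N}}$ and $(G_{2t+1})_{t \in \mathbb{N}}$ are time homogeneous Markov chains, with respective transition kernels $q_{\mathcal{R}}$ and $(\mathcal{G},\mathcal{G}') \mapsto P(G_3 = \mathcal{G}' \mid G_1 = \mathcal{G})$.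 The set of states reachable from any $\mathcal{T} \in \mathfrak{T}$ for the first kernel, and from any $\mathcal{G} \in \mathfrak{F}_1$ for the second one, is finite. Both chains are recurrent: their respective state spaces $\mathfrak{T}$ and $\mathfrak{F}_1$ are partitioned into finite closed communicating classes, made of positive recurrent states. \end{enumerate} -/

import Mathlib

open MeasureTheory ProbabilityTheory
open scoped ENNReal NNReal

noncomputable section

/-! ### Discrete-time Markov chains with discrete transition probabilities -/

namespace ToricGrammar

universe u v

/-- `X` is a Markov chain under `μ` whose transition probability from time `n` to time `n + 1` is
`k n`: given a history `X 0 = x 0, …, X n = x n`, the probability that `X (n + 1) = x (n + 1)` is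
`k n (x n) (x (n + 1))`. Written without division, so that histories of probability zero
impose nothing. All subsets of the state space are measurable. -/
def IsMarkovChain {E : Type u} {Ω : Type v} [MeasurableSpace Ω] (μ : Measure Ω)
    (X : ℕ → Ω → E) (k : ℕ → E → E → ℝ≥0∞) : Prop :=
  (∀ n, @Measurable Ω E _ ⊤ (X n)) ∧
  ∀ (n : ℕ) (x : ℕ → E),
    μ {ω | ∀ i ≤ n + 1, X i ω = x i} = μ {ω | ∀ i ≤ n, X i ω = x i} * k n (x n) (x (n + 1))

/-- A time homogeneous stopped Markov chain on `E` driven by the rule `β : E → Set E`, given as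
the family of its laws from every starting point. While `β` is nonempty at the current state, the
chain moves with positive probability exactly to the elements of `β`; it is stopped (and frozen)
as soon as `β` is empty at the current state. -/
structure StoppedMarkovChain (E : Type u) (β : E → Set E) (Ω : Type v) [MeasurableSpace Ω] where
  /-- the law of the chain, conditionally on its starting point -/
  law : E → Measure Ω
  /-- the path of the chain -/
  path : ℕ → Ω → E
  /-- the one-step transition probabilities -/
  step : E → PMF E
  isProbabilityMeasure : ∀ x, IsProbabilityMeasure (law x)
  start : ∀ x, ∀ᵐ ω ∂(law x), path 0 ω = x
  markov : ∀ x, IsMarkovChain (law x) path (fun _ y z => step y z)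
  step_pos_iff : ∀ x, β x ≠ ∅ → ∀ y, 0 < step x y ↔ y ∈ β x
  step_of_stopped : ∀ x, β x = ∅ → step x = PMF.pure x

namespace StoppedMarkovChain

variable {E : Type u} {β : E → Set E} {Ω : Type v} [MeasurableSpace Ω]

/-- The stopping time `inf {t | β (path t) = ∅}`, infinite if there is no such `t`. -/
def stoppingTime (S : StoppedMarkovChain E β Ω) (ω : Ω) : ℕ∞ :=
  ⨅ (n : ℕ) (_ : β (S.path n ω) = ∅), (n : ℕ∞)

/-- The event that the stopping time is finite and the chain is stopped in the set `A`. -/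
def outputIn (S : StoppedMarkovChain E β Ω) (A : Set E) : Set Ω :=
  {ω | ∃ n : ℕ, S.stoppingTime ω = n ∧ S.path n ω ∈ A}

/-- Probability, starting from `x`, to be stopped at `y`. -/
def outputProb (S : StoppedMarkovChain E β Ω) (x y : E) : ℝ≥0∞ :=
  S.law x (S.outputIn {y})

/-- Probability, starting from `x`, to be stopped at `y`, conditionally on being stopped in `A`. -/
def condOutputProb (S : StoppedMarkovChain E β Ω) (A : Set E) (x y : E) : ℝ≥0∞ :=
  (ProbabilityTheory.cond (S.law x) (S.outputIn A)) (S.outputIn {y})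

end StoppedMarkovChain

/-! ### Recurrence and communicating classes of a transition kernel -/

section Kernels

variable {E : Type u}

/-- Composition of two transition kernels on a discrete space. -/
def compKernel (k l : E → E → ℝ≥0∞) (x y : E) : ℝ≥0∞ := ∑' z, k x z * l z y

open Classical in
/-- `n`-step transition probabilities. -/
def iterKernel (q : E → E → ℝ≥0∞) : ℕ → E → E → ℝ≥0∞
  | 0 => fun x y => if x = y then 1 else 0
  | n + 1 => compKernel q (iterKernel q n)

/-- The states that can be reached from `x` in any number (possibly zero) of steps. -/
def reachable (q : E → E → ℝ≥0∞) (x : E) : Set E := {y | ∃ n, 0 < iterKernel q n x y}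

/-- The communicating class of `x`. -/
def communicatingClass (q : E → E → ℝ≥0∞) (x : E) : Set E :=
  {y | y ∈ reachable q x ∧ x ∈ reachable q y}

open Classical in
/-- `firstPassage q n x y` is the probability that the first visit to `y` at a time `≥ 1`,
starting from `x`, takes place at time `n + 1`. -/
def firstPassage (q : E → E → ℝ≥0∞) : ℕ → E → E → ℝ≥0∞
  | 0 => q
  | n + 1 => fun x y => ∑' z, if z = y then 0 else q x z * firstPassage q n z y

/-- Almost sure return. -/
def IsRecurrent (q : E → E → ℝ≥0∞) (x : E) : Prop := ∑' n, firstPassage q n x x = 1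

/-- Almost sure return, with a return time of finite expectation. -/
def IsPositiveRecurrent (q : E → E → ℝ≥0∞) (x : E) : Prop :=
  IsRecurrent q x ∧ ∑' n : ℕ, ((n + 1 : ℕ) : ℝ≥0∞) * firstPassage q n x x < ∞

/-- The state space `X` is partitioned into finite communicating classes, each of which is closed
(the kernel restricted to it has total mass one and does not leave it) and made of
positive recurrent states. -/
def SplitsIntoFinitePositiveRecurrentClasses (q : E → E → ℝ≥0∞) (X : Set E) : Prop :=
  ∃ 𝒞 : Set (Set E), ⋃₀ 𝒞 = X ∧ 𝒞.PairwiseDisjoint id ∧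
    ∀ C ∈ 𝒞, C.Nonempty ∧ C.Finite ∧ ∀ x ∈ C,
      communicatingClass q x = C ∧ (∀ y, 0 < q x y → y ∈ C) ∧ ∑' y : C, q x y = 1 ∧
        IsPositiveRecurrent q x

end Kernels

/-! ### Expressions, toric grammars and texts -/

/-- Symbols over the dictionary `D`: words, opening brackets and closing brackets. -/
inductive Symb (D : Type u) : Type u
  | word (w : D) : Symb D
  | opening (i : ℕ) : Symb D
  | closing (i : ℕ) : Symb D

variable {D : Type u}

/-- Words and closing brackets with a positive label: the symbols allowed after the opening
bracket of an expression. -/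
def Symb.IsInner : Symb D → Prop
  | .word _ => True
  | .opening _ => False
  | .closing j => 0 < j

/-- Expressions: the circular permutations of sequences made of an opening bracket followed by a
nonempty sequence of words and of closing brackets with positive labels, this sequence not being
reduced to one closing bracket. -/
def IsExpr (e : List (Symb D)) : Prop :=
  ∃ (i : ℕ) (a : List (Symb D)), a ≠ [] ∧ (∀ s ∈ a, s.IsInner) ∧ (∀ j, a ≠ [.closing j]) ∧
    (Symb.opening i :: a) ~r e

/-- Global expressions: those whose opening bracket has the label zero. -/
def IsGlobalExpr (e : List (Symb D)) : Prop :=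
  IsExpr e ∧ ∃ c : List (Symb D), c ≠ [] ∧ (Symb.opening 0 :: c) ~r e

/-- Toric grammars: positive measures with finite support on the set of expressions, invariant
under circular permutations, given by the weights of single expressions. -/
@[ext]
structure Grammar (D : Type u) : Type u where
  weight : List (Symb D) → ℝ≥0
  finite_support : (Function.support weight).Finite
  isExpr_of_weight_ne_zero : ∀ e, weight e ≠ 0 → IsExpr e
  weight_eq_of_isRotated : ∀ e f, e ~r f → weight e = weight f

/-- Texts: toric grammars with integer weights supported by the circular permutations of the
sequences made of the opening bracket with label zero and a nonempty sequence of words. -/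
def texts (D : Type u) : Set (Grammar D) :=
  {T | ∀ e, (∃ n : ℕ, T.weight e = n) ∧
    (T.weight e ≠ 0 → ∃ w : List D, w ≠ [] ∧ (Symb.opening 0 :: w.map Symb.word) ~r e)}

open Classical in
/-- The measure `∑ s ∈ 𝔖(e), δ_s`, where `𝔖(e)` is the set of circular permutations of `e`. -/
def unit (e : List (Symb D)) : List (Symb D) → ℝ≥0 := fun s => if e ~r s then 1 else 0

/-! ### Merges, narrow parsing, and the random processes -/

/-- The merge rule: `G'` is obtained from `G` by replacing `a ]_i` and `[_i b` with `a b`. -/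
def merge (G : Grammar D) : Set (Grammar D) :=
  {G' | ∃ (a b : List (Symb D)) (i : ℕ),
    IsExpr (a ++ [.closing i]) ∧ IsExpr (.opening i :: b) ∧ IsExpr (a ++ b) ∧
    G'.weight + unit (a ++ [.closing i]) + unit (.opening i :: b) = G.weight + unit (a ++ b)}

/-- The narrow parsing rule with reference grammar `R`: `G'` is obtained from `G` by splitting a
global expression `a b` into `a ]_i` and `[_i b`, where `R` gives a positive weight
to `[_i b`. -/
def narrowParse (R G : Grammar D) : Set (Grammar D) :=
  {G' | ∃ (a b : List (Symb D)) (i : ℕ),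
    IsExpr (a ++ [.closing i]) ∧ IsExpr (.opening i :: b) ∧ IsGlobalExpr (a ++ b) ∧
    0 < R.weight (.opening i :: b) ∧
    G'.weight + unit (a ++ b) = G.weight + unit (a ++ [.closing i]) + unit (.opening i :: b)}

/-- Parsing processes with reference grammar `R`. -/
abbrev ParsingProcess (R : Grammar D) (Ω : Type v) [MeasurableSpace Ω] :=
  StoppedMarkovChain (Grammar D) (narrowParse R) Ω

/-- Production processes. -/
abbrev ProductionProcess (D : Type u) (Ω : Type v) [MeasurableSpace Ω] :=
  StoppedMarkovChain (Grammar D) (merge (D := D)) Ω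

section SplitMerge

universe v₁ v₂ v₃

variable {Ω₁ : Type v₁} [MeasurableSpace Ω₁] {Ω₂ : Type v₂} [MeasurableSpace Ω₂]
  {Ω : Type v₃} [MeasurableSpace Ω] {R : Grammar D}

/-- The transition probability `P(G_{2t+1} = g' | G_{2t} = g) = P(S_τ = g' | S_0 = g)` of a split
and merge process. -/
def splitProb (S : ParsingProcess R Ω₁) (g g' : Grammar D) : ℝ≥0∞ := S.outputProb g g'

/-- The transition probability
`P(G_{2t+2} = g' | G_{2t+1} = g) = P(P_σ = g' | P_0 = g, P_σ is a text)` of a split and merge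
process. -/
def mergeProb (P : ProductionProcess D Ω₂) (g g' : Grammar D) : ℝ≥0∞ :=
  P.condOutputProb (texts D) g g'

/-- Two-step transition probabilities on texts, `P(G_2 = T' | G_0 = T)`: the communication
kernel. -/
def communicationKernel (S : ParsingProcess R Ω₁) (P : ProductionProcess D Ω₂) :
    Grammar D → Grammar D → ℝ≥0∞ :=
  compKernel (splitProb S) (mergeProb P)

/-- Two-step transition probabilities on grammars, `P(G_3 = g' | G_1 = g)`. -/
def grammarKernel (S : ParsingProcess R Ω₁) (P : ProductionProcess D Ω₂) :
    Grammar D → Grammar D → ℝ≥0∞ :=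
  compKernel (mergeProb P) (splitProb S)

/-- `G` is a split and merge process under `μ`, built from `S` and `P`: a Markov chain which starts
almost surely from a text and alternates the two kinds of transitions. -/
def IsSplitMergeProcess (S : ParsingProcess R Ω₁) (P : ProductionProcess D Ω₂)
    (μ : Measure Ω) (G : ℕ → Ω → Grammar D) : Prop :=
  IsProbabilityMeasure μ ∧ (∀ᵐ ω ∂μ, G 0 ω ∈ texts D) ∧
    IsMarkovChain μ G (fun n => if Even n then splitProb S else mergeProb P)

/-- The grammars charged by the law of `G (2 t + 1)` for some `t`. -/
def oddSupport (μ : Measure Ω) (G : ℕ → Ω → Grammar D) : Set (Grammar D) :=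
  {g | ∃ t : ℕ, 0 < μ {ω | G (2 * t + 1) ω = g}}

end SplitMerge

end ToricGrammar

end

open ToricGrammar

/-! A narrow split read backwards is a merge, so whenever parsing leads from a text T to a grammar
g, merging can lead from g back to T, and production stops there because a text has no closing
bracket. The converse is the crux. A run of merges from g to T may join two local fragments, a step
that narrow parsing, which only cuts global expressions, cannot undo. Such merges can be postponed.
If the fragment they produce is consumed by the next merge into a global expression, the two steps
are replaced with two merges into global expressions (`narrowMerge_two`); otherwise the two steps
commute. Since every expression of a text is global, no local merge survives
(`narrowMerge_of_merges`). A merge into a global expression is undone by a narrow split as soon as R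
charges the local fragment it consumes. Parsed grammars have this property, because parsing a text
creates only local fragments charged by R, and merging into global expressions creates no local ones
(`IsCharged`, `narrowParse_of_merges`).

Both rules branch finitely and lower an integer potential, so the two processes stop almost surely,
and the states where they stop with positive probability are exactly the reachable terminal ones
(`outputProb_pos_iff`). Positivity of a transition is thus a combinatorial matter, and both two-step
kernels are symmetric as far as positivity goes.

Both rules preserve the number of words, and a finite dictionary allows finitely many texts with a
bounded number of words; hence reachable sets are finite. By symmetry, reachability is an
equivalence relation whose classes are finite and closed. In such a class the probability of
avoiding a state decays geometrically, which gives positive recurrence.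

Weights are real, so the space of grammars is uncountable: the Markov property is only ever summed
over countable sets that carry the chain. -/

noncomputable section

namespace ToricGrammar

universe u

variable {D : Type u}

open Grammar

/-! ### Counting symbols, and a characterization of expressions invariant under permutations -/

/-- Opening brackets. -/
def Symb.isOpening : Symb D → Bool
  | .opening _ => true
  | _ => false

/-- Words of the dictionary. -/
def Symb.isWord : Symb D → Bool
  | .word _ => true
  | _ => false

/-- The opening bracket with label zero. -/
def Symb.isOpeningZero : Symb D → Bool
  | .opening 0 => true
  | _ => false

/-- The number of opening brackets. -/
def numOpening (e : List (Symb D)) : ℕ := e.countP Symb.isOpening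

/-- The number of words. -/
def numWord (e : List (Symb D)) : ℕ := e.countP Symb.isWord

/-- The number of opening brackets with label zero. -/
def numOpeningZero (e : List (Symb D)) : ℕ := e.countP Symb.isOpeningZero

@[simp] lemma numOpening_nil : numOpening ([] : List (Symb D)) = 0 := rfl
@[simp] lemma numWord_nil : numWord ([] : List (Symb D)) = 0 := rfl
@[simp] lemma numOpeningZero_nil : numOpeningZero ([] : List (Symb D)) = 0 := rfl

@[simp] lemma numOpening_append (a b : List (Symb D)) :
    numOpening (a ++ b) = numOpening a + numOpening b := List.countP_append

@[simp] lemma numWord_append (a b : List (Symb D)) :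
    numWord (a ++ b) = numWord a + numWord b := List.countP_append

@[simp] lemma numOpeningZero_append (a b : List (Symb D)) :
    numOpeningZero (a ++ b) = numOpeningZero a + numOpeningZero b := List.countP_append

@[simp] lemma numOpening_cons_opening (i : ℕ) (b : List (Symb D)) :
    numOpening (.opening i :: b) = numOpening b + 1 :=
  List.countP_cons_of_pos rfl

@[simp] lemma numOpening_cons_closing (i : ℕ) (b : List (Symb D)) :
    numOpening (.closing i :: b) = numOpening b := by
  simp [numOpening, Symb.isOpening]

@[simp] lemma numOpening_cons_word (w : D) (b : List (Symb D)) :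
    numOpening (.word w :: b) = numOpening b := by
  simp [numOpening, Symb.isOpening]

@[simp] lemma numWord_cons_opening (i : ℕ) (b : List (Symb D)) :
    numWord (.opening i :: b) = numWord b := by
  simp [numWord, Symb.isWord]

@[simp] lemma numWord_cons_closing (i : ℕ) (b : List (Symb D)) :
    numWord (.closing i :: b) = numWord b := by
  simp [numWord, Symb.isWord]

@[simp] lemma numWord_cons_word (w : D) (b : List (Symb D)) :
    numWord (.word w :: b) = numWord b + 1 :=
  List.countP_cons_of_pos rfl

@[simp] lemma numOpeningZero_cons_opening (i : ℕ) (b : List (Symb D)) :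
    numOpeningZero (.opening i :: b) = numOpeningZero b + if i = 0 then 1 else 0 := by
  cases i <;> simp [numOpeningZero, Symb.isOpeningZero]

@[simp] lemma numOpeningZero_cons_closing (i : ℕ) (b : List (Symb D)) :
    numOpeningZero (.closing i :: b) = numOpeningZero b := by
  simp [numOpeningZero, Symb.isOpeningZero]

@[simp] lemma numOpeningZero_cons_word (w : D) (b : List (Symb D)) :
    numOpeningZero (.word w :: b) = numOpeningZero b := by
  simp [numOpeningZero, Symb.isOpeningZero]

lemma numOpeningZero_le (e : List (Symb D)) : numOpeningZero e ≤ numOpening e := by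
  apply List.countP_mono_left
  rintro (_ | i | _) _ <;> simp [Symb.isOpening, Symb.isOpeningZero]

lemma numOpening_eq_of_isRotated {e f : List (Symb D)} (h : e ~r f) :
    numOpening e = numOpening f := h.perm.countP_eq _

lemma numWord_eq_of_isRotated {e f : List (Symb D)} (h : e ~r f) :
    numWord e = numWord f := h.perm.countP_eq _

lemma numOpeningZero_eq_of_isRotated {e f : List (Symb D)} (h : e ~r f) :
    numOpeningZero e = numOpeningZero f := h.perm.countP_eq _

lemma numOpening_eq_zero_of_isInner {a : List (Symb D)} (h : ∀ s ∈ a, s.IsInner) :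
    numOpening a = 0 := by
  refine List.countP_eq_zero.2 fun s hs => ?_
  have := h s hs
  cases s <;> simp_all [Symb.IsInner, Symb.isOpening]

/-- A list with exactly one opening bracket. -/
lemma exists_eq_append_opening {e : List (Symb D)} (h : numOpening e = 1) :
    ∃ (c d : List (Symb D)) (k : ℕ), e = c ++ .opening k :: d ∧
      numOpening c = 0 ∧ numOpening d = 0 := by
  have hp : 0 < e.countP Symb.isOpening := by unfold numOpening at h; omega
  obtain ⟨s, hs, ho⟩ := List.countP_pos_iff.1 hp
  obtain ⟨c, d, rfl⟩ := List.append_of_mem hs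
  cases s with
  | opening k =>
    refine ⟨c, d, k, rfl, ?_⟩
    simp at h; omega
  | word w => simp [Symb.isOpening] at ho
  | closing w => simp [Symb.isOpening] at ho

lemma append_isRotated_append (c d : List (Symb D)) : (c ++ d) ~r (d ++ c) :=
  List.IsRotated.symm List.isRotated_append

lemma isRotated_exists_append {l l' : List (Symb D)} (h : l ~r l') :
    ∃ c d, l = c ++ d ∧ l' = d ++ c := by
  obtain ⟨n, hn, rfl⟩ := List.isRotated_iff_mod.1 h
  exact ⟨l.take n, l.drop n, by simp, List.rotate_eq_drop_append_take hn⟩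

/-- Rotations do not move the opening bracket from the first place, if there is only one. -/
lemma eq_of_isRotated_opening {k m : ℕ} {a b : List (Symb D)} (hb : numOpening b = 0)
    (h : (Symb.opening k :: a) ~r (Symb.opening m :: b)) :
    Symb.opening k :: a = Symb.opening m :: b := by
  obtain ⟨c, d, h1, h2⟩ := isRotated_exists_append h
  cases c with
  | nil => simp_all
  | cons x c =>
    simp only [List.cons_append, List.cons.injEq] at h1
    obtain ⟨rfl, rfl⟩ := h1
    cases d with
    | nil => simp_all
    | cons y d =>
      simp only [List.cons_append, List.cons.injEq] at h2
      obtain ⟨rfl, rfl⟩ := h2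
      simp at hb

/-- All three conditions on the right are invariant under permutation of the symbols. Counting words
twice encodes the last requirement: the bound 3 rejects an opening bracket followed by a single
closing bracket, but accepts one followed by a single word. -/
lemma isExpr_iff {e : List (Symb D)} :
    IsExpr e ↔ numOpening e = 1 ∧ .closing 0 ∉ e ∧ 3 ≤ e.length + numWord e := by
  constructor
  · rintro ⟨i, a, h0, h1, h2, hr⟩
    rw [← numOpening_eq_of_isRotated hr, ← numWord_eq_of_isRotated hr, ← hr.perm.length_eq,
      ← hr.perm.mem_iff]
    refine ⟨by simp [numOpening_eq_zero_of_isInner h1], ?_, ?_⟩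
    · intro h
      simp only [List.mem_cons, reduceCtorEq, false_or] at h
      simpa [Symb.IsInner] using h1 _ h
    · match a, h0, h2, h1 with
      | [.word w], _, _, _ => simp
      | [.closing j], _, h2, _ => exact absurd rfl (h2 j)
      | [.opening j], _, _, h1 => simpa [Symb.IsInner] using h1 (.opening j)
      | x :: y :: l, _, _, _ => simp; omega
  · rintro ⟨h1, h2, h3⟩
    obtain ⟨c, d, k, rfl, hc, hd⟩ := exists_eq_append_opening h1
    have hr : (Symb.opening k :: (d ++ c)) ~r (c ++ .opening k :: d) :=
      (append_isRotated_append c (.opening k :: d)).symm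
    rw [← numWord_eq_of_isRotated hr, ← hr.perm.length_eq] at h3
    refine ⟨k, d ++ c, ?_, ?_, ?_, hr⟩
    · intro h
      rw [h] at h3
      simp at h3
    · intro s hs
      cases s with
      | word w => trivial
      | opening j =>
        have : 0 < numOpening (d ++ c) := List.countP_pos_iff.2 ⟨_, hs, rfl⟩
        simp [hc, hd] at this
      | closing j =>
        simp only [Symb.IsInner]
        rcases Nat.eq_zero_or_pos j with rfl | h
        · exact absurd (hr.perm.mem_iff.1 (List.mem_cons_of_mem _ hs)) h2
        · exact h
    · intro j h
      rw [h] at h3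
      simp at h3

lemma isGlobalExpr_iff {e : List (Symb D)} :
    IsGlobalExpr e ↔ IsExpr e ∧ numOpeningZero e = 1 := by
  refine and_congr_right fun he => ?_
  constructor
  · rintro ⟨c, -, hr⟩
    have := numOpeningZero_le e
    have := (isExpr_iff.1 he).1
    rw [← numOpeningZero_eq_of_isRotated hr] at *
    simp at *; omega
  · intro h
    obtain ⟨i, a, h0, h1, -, hr⟩ := he
    have h2 := numOpeningZero_le a
    rw [numOpening_eq_zero_of_isInner h1] at h2
    rw [← numOpeningZero_eq_of_isRotated hr] at h
    simp only [numOpeningZero_cons_opening] at h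
    have : i = 0 := by by_contra hi; simp [hi] at h; omega
    subst this
    exact ⟨a, h0, hr⟩

lemma IsExpr.congr {e f : List (Symb D)} (he : IsExpr e) (h : e ~r f) : IsExpr f := by
  obtain ⟨i, a, h0, h1, h2, hr⟩ := he
  exact ⟨i, a, h0, h1, h2, hr.trans h⟩

/-! ### The combinatorics of splitting an expression -/

/-- The expression `a b` can be split into `a ]_i` and `[_i b`. -/
structure IsSplit (a b : List (Symb D)) (i : ℕ) : Prop where
  left : IsExpr (a ++ [.closing i])
  right : IsExpr (.opening i :: b)
  whole : IsExpr (a ++ b)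

/-- The unique opening bracket of the whole must lie in `a`, since the right fragment brings its
own. The bounds 2 are the bound 3 of `isExpr_iff` minus the bracket added to each side. -/
lemma isSplit_iff {a b : List (Symb D)} {i : ℕ} :
    IsSplit a b i ↔ numOpening a = 1 ∧ numOpening b = 0 ∧ .closing 0 ∉ a ∧ .closing 0 ∉ b ∧
      i ≠ 0 ∧ 2 ≤ a.length + numWord a ∧ 2 ≤ b.length + numWord b := by
  constructor
  · rintro ⟨h1, h2, h3⟩
    simp [isExpr_iff] at h1 h2 h3
    refine ⟨?_, ?_, ?_, ?_, ?_, ?_, ?_⟩ <;> first | omega | tauto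
  · rintro ⟨h1, h2, h3, h4, h5, h6, h7⟩
    refine ⟨?_, ?_, ?_⟩ <;> simp [isExpr_iff, h1, h2, h3, h4] <;> omega

lemma numOpeningZero_eq_zero {b : List (Symb D)} (h : numOpening b = 0) :
    numOpeningZero b = 0 := by
  have := numOpeningZero_le b; omega

namespace IsSplit

variable {a b : List (Symb D)} {i : ℕ} (h : IsSplit a b i)
include h

/-- Replacing `b` with one closing bracket strictly lowers length plus number of words, because `b`
weighs at least 2. -/
lemma not_isRotated_left : ¬ (a ++ b) ~r (a ++ [.closing i]) := by
  intro hr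
  have h1 := hr.perm.length_eq
  have h2 := numWord_eq_of_isRotated hr
  have := isSplit_iff.1 h
  simp at h1 h2; omega

lemma not_isRotated_right : ¬ (a ++ b) ~r (.opening i :: b) := by
  intro hr
  have h1 := hr.perm.length_eq
  have h2 := numWord_eq_of_isRotated hr
  have := isSplit_iff.1 h
  simp at h1 h2; omega

/-- The left fragment keeps the opening bracket, so it is global exactly when the whole is; the
right fragment has a nonzero label and is always local. -/
lemma numOpeningZero_left : numOpeningZero (a ++ [.closing i]) = numOpeningZero (a ++ b) := by
  have := isSplit_iff.1 h
  simp [numOpeningZero_eq_zero this.2.1]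

lemma numOpeningZero_right : numOpeningZero (.opening i :: b) = 0 := by
  have := isSplit_iff.1 h
  simp [numOpeningZero_eq_zero this.2.1, this]

end IsSplit

/-! ### The additive structure of toric grammars -/

namespace Grammar

lemma weight_injective : Function.Injective (weight (D := D)) := fun _ _ h => Grammar.ext h

instance : Zero (Grammar D) := ⟨⟨0, by simp, by simp, by simp⟩⟩

instance : Add (Grammar D) :=
  ⟨fun G H => ⟨G.weight + H.weight,
    (G.finite_support.union H.finite_support).subset (Function.support_add _ _),
    fun e he => by
      by_cases h : G.weight e = 0
      · exact H.isExpr_of_weight_ne_zero e (by simpa [h] using he)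
      · exact G.isExpr_of_weight_ne_zero e h,
    fun e f h => by
      simp [G.weight_eq_of_isRotated e f h, H.weight_eq_of_isRotated e f h]⟩⟩

instance : SMul ℕ (Grammar D) := ⟨fun n G => nsmulRec n G⟩

@[simp] lemma weight_add (G H : Grammar D) : (G + H).weight = G.weight + H.weight := rfl

/-- Cancellation replaces subtraction of measures: removing an expression from a grammar becomes a
decomposition as a sum. -/
instance : AddCancelCommMonoid (Grammar D) :=
  Function.Injective.addCancelCommMonoid _ weight_injective rfl (fun _ _ => rfl) (fun G n => by
    induction n with
    | zero => simp only [zero_smul]; rfl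
    | succ n ih => rw [succ_nsmul, ← ih]; rfl)

variable {e f : List (Symb D)}

lemma unit_self (e : List (Symb D)) : unit e e = 1 := if_pos (List.IsRotated.refl e)

lemma unit_of_isRotated (h : e ~r f) : unit e f = 1 := by simp [unit, h]

lemma unit_of_not_isRotated (h : ¬ e ~r f) : unit e f = 0 := by simp [unit, h]

lemma unit_congr {s t : List (Symb D)} (h : e ~r s ↔ f ~r t) : unit e s = unit f t := by
  by_cases hs : e ~r s
  · rw [unit_of_isRotated hs, unit_of_isRotated (h.1 hs)]
  · rw [unit_of_not_isRotated hs, unit_of_not_isRotated (hs ∘ h.2)]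

/-- The sum of the unit masses at the circular permutations of an expression. -/
def single (e : List (Symb D)) (he : IsExpr e) : Grammar D where
  weight := unit e
  finite_support := by
    classical
    refine (List.finite_toSet e.cyclicPermutations).subset fun s hs => ?_
    have : e ~r s := by by_contra h; simp [unit, h] at hs
    exact List.mem_cyclicPermutations_iff.2 this.symm
  isExpr_of_weight_ne_zero s hs := by
    have : e ~r s := by by_contra h; simp [unit, h] at hs
    exact he.congr this
  weight_eq_of_isRotated s t h := by
    exact unit_congr ⟨fun h' => h'.trans h, fun h' => h'.trans h.symm⟩

@[simp] lemma weight_single (he : IsExpr e) : (single e he).weight = unit e := rfl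

lemma single_congr (he : IsExpr e) (h : e ~r f) : single e he = single f (he.congr h) := by
  ext1
  funext s
  exact unit_congr ⟨fun h' => h.symm.trans h', fun h' => h.trans h'⟩

lemma exists_eq_add_single (G : Grammar D) (he : IsExpr e) (h : 1 ≤ G.weight e) :
    ∃ H, G = H + single e he := by
  refine ⟨⟨G.weight - unit e, G.finite_support.subset ?_, ?_, ?_⟩, ?_⟩
  · intro s hs hG
    simp [hG] at hs
  · intro s hs
    exact G.isExpr_of_weight_ne_zero s fun hG => by simp [hG] at hs
  · intro s t hst
    have := (single e he).weight_eq_of_isRotated s t hst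
    rw [weight_single] at this
    simp only [Pi.sub_apply, G.weight_eq_of_isRotated s t hst, this]
  · ext1
    funext s
    simp only [weight_add, weight_single, Pi.add_apply, Pi.sub_apply]
    refine (tsub_add_cancel_of_le ?_).symm
    by_cases hs : e ~r s
    · rwa [unit_of_isRotated hs, ← G.weight_eq_of_isRotated e s hs]
    · simp [unit_of_not_isRotated hs]

lemma one_le_weight_add_single (H : Grammar D) (he : IsExpr e) :
    1 ≤ (H + single e he).weight e := by
  simp [unit_self]

/-- Two different expressions that are both removed from a grammar. -/
lemma exists_of_add_single_eq {G H : Grammar D} (he : IsExpr e) (hf : IsExpr f)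
    (h : G + single e he = H + single f hf) (hef : ¬ e ~r f) :
    ∃ K, G = K + single f hf ∧ H = K + single e he := by
  have h1 : 1 ≤ G.weight f := by
    have := one_le_weight_add_single H hf
    rw [← h] at this
    simpa [unit_of_not_isRotated hef] using this
  obtain ⟨K, rfl⟩ := exists_eq_add_single G hf h1
  exact ⟨K, rfl, add_right_cancel (b := single f hf) (by rw [← h]; abel)⟩

end Grammar

/-- `G'` is obtained by merging `a ]_i` and `[_i b` in `G`; equivalently, `G` is obtained by
splitting `a b` in `G'`. -/
def MergeAt (a b : List (Symb D)) (i : ℕ) (G G' : Grammar D) : Prop :=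
  ∃ (h : IsSplit a b i) (H : Grammar D),
    G = H + single _ h.left + single _ h.right ∧ G' = H + single _ h.whole

lemma mergeAt_iff {a b : List (Symb D)} {i : ℕ} {G G' : Grammar D} :
    MergeAt a b i G G' ↔ IsSplit a b i ∧
      G'.weight + unit (a ++ [.closing i]) + unit (.opening i :: b) =
        G.weight + unit (a ++ b) := by
  constructor
  · rintro ⟨h, H, rfl, rfl⟩
    refine ⟨h, ?_⟩
    simp only [weight_add, weight_single]
    abel
  · rintro ⟨h, hw⟩
    refine ⟨h, ?_⟩
    have hw' : G' + single _ h.left + single _ h.right = G + single _ h.whole :=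
      Grammar.ext hw
    -- The whole is a rotation of neither fragment, so its unit mass on the right-hand side must
    -- come from `G'`. Peeling it off `G'` is enough; cancellation then determines `G`.
    have h1 : 1 ≤ G'.weight (a ++ b) := by
      have := one_le_weight_add_single G h.whole
      rw [← hw'] at this
      simpa [unit_of_not_isRotated fun h' => h.not_isRotated_left h'.symm,
        unit_of_not_isRotated fun h' => h.not_isRotated_right h'.symm] using this
    obtain ⟨H, rfl⟩ := exists_eq_add_single G' h.whole h1
    exact ⟨H, add_right_cancel (b := single _ h.whole) (by rw [← hw']; abel), rfl⟩

lemma mem_merge_iff {G G' : Grammar D} : G' ∈ merge G ↔ ∃ a b i, MergeAt a b i G G' := by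
  simp only [mergeAt_iff]
  constructor
  · rintro ⟨a, b, i, h1, h2, h3, h4⟩
    exact ⟨a, b, i, ⟨h1, h2, h3⟩, h4⟩
  · rintro ⟨a, b, i, ⟨h1, h2, h3⟩, h4⟩
    exact ⟨a, b, i, h1, h2, h3, h4⟩

lemma mem_narrowParse_iff {R G G' : Grammar D} : G' ∈ narrowParse R G ↔
    ∃ a b i, MergeAt a b i G' G ∧ numOpeningZero (a ++ b) = 1 ∧
      R.weight (.opening i :: b) ≠ 0 := by
  simp only [mergeAt_iff]
  constructor
  · rintro ⟨a, b, i, h1, h2, h3, h4, h5⟩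
    rw [isGlobalExpr_iff] at h3
    exact ⟨a, b, i, ⟨⟨h1, h2, h3.1⟩, by rw [h5]⟩, h3.2, h4.ne'⟩
  · rintro ⟨a, b, i, ⟨⟨h1, h2, h3⟩, h4⟩, h5, h6⟩
    exact ⟨a, b, i, h1, h2, isGlobalExpr_iff.2 ⟨h3, h5⟩, pos_iff_ne_zero.2 h6, by rw [h4]⟩

lemma mem_merge_of_mem_narrowParse {R G G' : Grammar D} (h : G' ∈ narrowParse R G) :
    G ∈ merge G' := by
  obtain ⟨a, b, i, h, -, -⟩ := mem_narrowParse_iff.1 h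
  exact mem_merge_iff.2 ⟨a, b, i, h⟩

/-! ### Reordering merges -/

/-- A merge whose result is a global expression. -/
def NarrowMerge (G G' : Grammar D) : Prop :=
  ∃ a b i, MergeAt a b i G G' ∧ numOpeningZero (a ++ b) = 1

/-- The support of the grammar consists of global expressions. -/
def IsGlobal (G : Grammar D) : Prop := ∀ e, G.weight e ≠ 0 → numOpeningZero e = 1

/-- Merging inside a nonglobal expression which is later merged into a global expression can be
replaced with two merges into global expressions. -/
lemma narrowMerge_two {a b u v : List (Symb D)} {i m : ℕ} (h : IsSplit a b i)
    (h' : IsSplit u v m) (hu : numOpeningZero (u ++ v) = 1)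
    (hr : (a ++ b) ~r (.opening m :: v)) (H : Grammar D) :
    ∃ K, NarrowMerge (H + single _ h.left + single _ h.right + single _ h'.left) K ∧
      NarrowMerge K (H + single _ h'.whole) := by
  have ha := isSplit_iff.1 h
  have hu' := isSplit_iff.1 h'
  have ha0 := ha.2.2.2.2.1
  -- With `a = c [_k d`, the merged fragment rotates to `[_k d b c`, which forces `m = k` and `v = d
  -- b c`.
  obtain ⟨c, d, k, rfl, hc, hd⟩ := exists_eq_append_opening ha.1
  have hr' : (Symb.opening k :: (d ++ (b ++ c))) ~r (.opening m :: v) := by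
    refine List.IsRotated.trans ?_ hr
    simpa using append_isRotated_append (.opening k :: (d ++ b)) c
  have key := eq_of_isRotated_opening hu'.2.1 hr'
  simp only [List.cons.injEq, Symb.opening.injEq] at key
  obtain ⟨rfl, rfl⟩ := key
  have hz := numOpeningZero_eq_zero ha.2.1
  have hzc := numOpeningZero_eq_zero hc
  have hzd := numOpeningZero_eq_zero hd
  simp [hz, hzc, hzd] at hu
  simp [hc, hd] at ha hu'
  -- First merge `u ]_k` with `[_k d ]_i c`, a rotation of `a ]_i`. The result `u d ]_i c` rotates
  -- to `c u d ]_i`.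
  have s1 : IsSplit u (d ++ [.closing i] ++ c) k := by
    rw [isSplit_iff]
    simp only [numOpening_append, numWord_append, List.length_append, List.mem_append]
    simp [hc, hd, hu', ne_comm.1 ha0]
    omega
  -- Then merge `c u d ]_i` with `[_i b`; the result rotates to `u d b c = u v`. Both results are
  -- global because `u` contains the bracket with label zero.
  have s2 : IsSplit (c ++ u ++ d) b i := by
    rw [isSplit_iff]
    simp [hc, hd, hu', ha]
    omega
  have r1 : (c ++ .opening k :: d ++ [.closing i]) ~r
      (.opening k :: (d ++ [.closing i] ++ c)) := by
    have := append_isRotated_append c (.opening k :: (d ++ [.closing i]))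
    simp only [List.append_assoc, List.cons_append] at this ⊢
    exact this
  have r2 : (u ++ (d ++ [.closing i] ++ c)) ~r (c ++ u ++ d ++ [.closing i]) := by
    have := append_isRotated_append (u ++ (d ++ [.closing i])) c
    simp only [List.append_assoc] at this ⊢
    exact this
  have r3 : (c ++ u ++ d ++ b) ~r (u ++ (d ++ (b ++ c))) := by
    simpa using append_isRotated_append c (u ++ (d ++ b))
  refine ⟨H + single _ h.right + single _ s1.whole,
    ⟨u, _, k, ⟨s1, H + single _ h.right, ?_, rfl⟩, by simp [hu, hzc, hzd]⟩,
    ⟨_, b, i, ⟨s2, H, ?_, ?_⟩, by simp [hu, hzc, hzd, hz]⟩⟩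
  · rw [single_congr h.left r1]; abel
  · rw [single_congr s1.whole r2]; abel
  · rw [single_congr s2.whole r3]

lemma narrowMerge_of_merge {G G₁ T : Grammar D} (hG : G₁ ∈ merge G)
    (hT : Relation.ReflTransGen NarrowMerge G₁ T) (hglobal : IsGlobal T) :
    Relation.ReflTransGen NarrowMerge G T := by
  induction hT using Relation.ReflTransGen.head_induction_on generalizing G with
  | refl =>
    obtain ⟨a, b, i, h⟩ := mem_merge_iff.1 hG
    -- The merge is the last one, so its result is still present in the final grammar and is
    -- therefore global.
    refine .single ⟨a, b, i, h, hglobal _ ?_⟩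
    obtain ⟨h, H, -, rfl⟩ := h
    exact (lt_of_lt_of_le one_pos (one_le_weight_add_single H h.whole)).ne'
  | head hstep hrest ih =>
    obtain ⟨a, b, i, hm⟩ := mem_merge_iff.1 hG
    by_cases hz : numOpeningZero (a ++ b) = 1
    · exact .head ⟨a, b, i, hm, hz⟩ (.head hstep hrest)
    obtain ⟨h, H, rfl, rfl⟩ := hm
    obtain ⟨u, v, m, ⟨h', H', he, rfl⟩, hu⟩ := hstep
    -- A local result cannot play the role of the left fragment of a merge into a global expression,
    -- since that fragment is global.
    have hzu : ¬ (a ++ b) ~r (u ++ [.closing m]) := fun hr => by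
      rw [numOpeningZero_eq_of_isRotated hr, h'.numOpeningZero_left] at hz
      exact hz hu
    by_cases hr : (a ++ b) ~r (.opening m :: v)
    · rw [single_congr h.whole hr] at he
      obtain rfl := add_right_cancel he
      obtain ⟨K, hK1, hK2⟩ := narrowMerge_two h h' hu hr H'
      refine .head (b := K) ?_ (.head hK2 hrest)
      convert hK1 using 1
      abel
    -- The next merge consumes neither copy of the new fragment's mass, so its two operands were
    -- already available: perform it first and push the local merge further along the run.
    · obtain ⟨K, rfl, hK⟩ := exists_of_add_single_eq _ _ he hr
      obtain ⟨L, rfl, rfl⟩ := exists_of_add_single_eq _ _ hK.symm hzu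
      refine .head (b := L + single _ h.left + single _ h.right + single _ h'.whole)
        ⟨u, v, m, ⟨h', L + single _ h.left + single _ h.right, by abel, by abel⟩, hu⟩
        (ih (mem_merge_iff.2 ⟨a, b, i, h, L + single _ h'.whole, by abel, by abel⟩))

/-- A sequence of merges producing a grammar made of global expressions can be replaced with a
sequence of merges into global expressions. -/
lemma narrowMerge_of_merges {G T : Grammar D}
    (hT : Relation.ReflTransGen (fun G G' => G' ∈ merge G) G T) (hglobal : IsGlobal T) :
    Relation.ReflTransGen NarrowMerge G T := by
  induction hT using Relation.ReflTransGen.head_induction_on with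
  | refl => exact .refl
  | head h _ ih => exact narrowMerge_of_merge h ih hglobal

/-! ### Undoing merges by narrow parsing -/

/-- The grammar `R` charges all the nonglobal expressions of `G`. -/
def IsCharged (R G : Grammar D) : Prop :=
  ∀ e, G.weight e ≠ 0 → numOpeningZero e = 0 → R.weight e ≠ 0

/-- The only local expression created by a narrow split is its right fragment, which R charges by
the rule itself. -/
lemma IsCharged.narrowParse {R G G' : Grammar D} (h : IsCharged R G)
    (hG : G' ∈ narrowParse R G) : IsCharged R G' := by
  obtain ⟨a, b, i, ⟨h', H, rfl, rfl⟩, hz, hR⟩ := mem_narrowParse_iff.1 hG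
  intro e he hze
  have h1 : ¬ (a ++ [.closing i]) ~r e := fun hr => by
    rw [← numOpeningZero_eq_of_isRotated hr, h'.numOpeningZero_left] at hze
    omega
  by_cases h2 : (.opening i :: b) ~r e
  · rwa [← R.weight_eq_of_isRotated _ _ h2]
  · refine h e ?_ hze
    simp [unit_of_not_isRotated h1, unit_of_not_isRotated h2] at he
    simp [he]

/-- The right fragment is a local expression of `G`, hence charged by R, and this is the condition
for the reverse split. The new expression is global, so the invariant passes to `G'`. -/
lemma NarrowMerge.narrowParse {R G G' : Grammar D} (h : IsCharged R G)
    (hG : NarrowMerge G G') : G ∈ narrowParse R G' ∧ IsCharged R G' := by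
  obtain ⟨a, b, i, hm, hz⟩ := hG
  have hR : R.weight (.opening i :: b) ≠ 0 := by
    obtain ⟨h', H, rfl, rfl⟩ := hm
    exact h _ (lt_of_lt_of_le one_pos (one_le_weight_add_single _ h'.right)).ne'
      h'.numOpeningZero_right
  refine ⟨mem_narrowParse_iff.2 ⟨a, b, i, hm, hz, hR⟩, ?_⟩
  obtain ⟨h', H, rfl, rfl⟩ := hm
  intro e he hze
  have h1 : ¬ (a ++ b) ~r e := fun hr => by
    rw [← numOpeningZero_eq_of_isRotated hr] at hze
    omega
  refine h e ?_ hze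
  simp [unit_of_not_isRotated h1] at he
  simp [he]

/-- Any sequence of merges from a charged grammar to a grammar made of global expressions can be
undone by narrow parsing. -/
lemma narrowParse_of_merges {R G T : Grammar D} (h : IsCharged R G)
    (hT : Relation.ReflTransGen (fun G G' => G' ∈ merge G) G T) (hglobal : IsGlobal T) :
    Relation.ReflTransGen (fun G G' => G' ∈ narrowParse R G) T G := by
  have hN := narrowMerge_of_merges hT hglobal
  clear hT
  induction hN using Relation.ReflTransGen.head_induction_on with
  | refl => exact .refl
  | head hs _ ih =>
    obtain ⟨h1, h2⟩ := hs.narrowParse h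
    exact (ih h2).tail h1

lemma merges_of_narrowParse {R G T : Grammar D}
    (hT : Relation.ReflTransGen (fun G G' => G' ∈ narrowParse R G) T G) :
    Relation.ReflTransGen (fun G G' => G' ∈ merge G) G T := by
  induction hT with
  | refl => exact .refl
  | tail _ hs ih => exact .head (mem_merge_of_mem_narrowParse hs) ih

/-! ### Additive functionals of toric grammars -/

open Classical in
/-- The sum of the values of `φ` at the expressions of the grammar, represented by their circular
permutation that starts with the opening bracket. -/
def Grammar.total (φ : List (Symb D) → ℕ) (G : Grammar D) : ℝ≥0 :=
  ∑ᶠ e, G.weight e * (if ∃ k a, e = .opening k :: a then φ e else 0 : ℕ)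

lemma Grammar.total_add (φ : List (Symb D) → ℕ) (G H : Grammar D) :
    (G + H).total φ = G.total φ + H.total φ := by
  unfold Grammar.total
  rw [← finsum_add_distrib]
  · simp only [weight_add, Pi.add_apply, add_mul]
  · exact G.finite_support.subset (Function.support_mul_subset_left _ _)
  · exact H.finite_support.subset (Function.support_mul_subset_left _ _)

/-- An expression has exactly one rotation that begins with its opening bracket, so an invariant `φ`
is counted once. -/
lemma Grammar.total_single {φ : List (Symb D) → ℕ} (hφ : ∀ e f, e ~r f → φ e = φ f)
    {e : List (Symb D)} (he : IsExpr e) : (single e he).total φ = φ e := by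
  obtain ⟨i, a, h0, h1, h2, hr⟩ := id he
  unfold Grammar.total
  rw [finsum_eq_single _ (.opening i :: a)]
  · simp [unit_of_isRotated hr.symm, hφ _ _ hr]
  · intro f hf
    by_cases h : ∃ k b, f = .opening k :: b
    · obtain ⟨k, b, rfl⟩ := h
      have : ¬ e ~r (.opening k :: b) := fun h' =>
        hf (eq_of_isRotated_opening (numOpening_eq_zero_of_isInner h1) (hr.trans h').symm)
      simp [unit_of_not_isRotated this]
    · simp [h]

/-- The total number of expressions of a grammar decreases when expressions are merged. -/
lemma total_one_of_mem_merge {G G' : Grammar D} (h : G' ∈ merge G) :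
    G.total (fun _ => 1) = G'.total (fun _ => 1) + 1 := by
  obtain ⟨a, b, i, h, H, rfl, rfl⟩ := mem_merge_iff.1 h
  simp only [total_add, total_single (φ := fun _ : List (Symb D) => 1) fun _ _ _ => rfl]
  push_cast
  ring

lemma total_numWord_of_mem_merge {G G' : Grammar D} (h : G' ∈ merge G) :
    G.total numWord = G'.total numWord := by
  obtain ⟨a, b, i, h, H, rfl, rfl⟩ := mem_merge_iff.1 h
  simp only [total_add, total_single fun _ _ => numWord_eq_of_isRotated]
  simp [add_assoc]

/-- A potential which decreases when global expressions are split. -/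
def globalSize (e : List (Symb D)) : ℕ := numOpeningZero e * (e.length + numWord e)

lemma globalSize_eq_of_isRotated (e f : List (Symb D)) (h : e ~r f) :
    globalSize e = globalSize f := by
  rw [globalSize, globalSize, numOpeningZero_eq_of_isRotated h, numWord_eq_of_isRotated h,
    h.perm.length_eq]

lemma total_globalSize_of_mem_narrowParse {R G G' : Grammar D} (h : G' ∈ narrowParse R G) :
    G'.total globalSize + 1 ≤ G.total globalSize := by
  obtain ⟨a, b, i, ⟨hs, H, rfl, rfl⟩, hz, -⟩ := mem_narrowParse_iff.1 h
  simp only [total_add, total_single globalSize_eq_of_isRotated]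
  -- The right fragment is local and counts for zero; in the left one, `b`, which weighs at least 2,
  -- is replaced with a closing bracket of weight 1.
  have h1 : globalSize (a ++ [.closing i]) + globalSize (.opening i :: b) + 1 ≤
      globalSize (a ++ b) := by
    have := isSplit_iff.1 hs
    simp only [globalSize, hs.numOpeningZero_left, hs.numOpeningZero_right, hz]
    simp
    omega
  have h2 : (globalSize (a ++ [.closing i]) + globalSize (.opening i :: b) + 1 : ℝ≥0) ≤
      globalSize (a ++ b) := mod_cast h1
  calc _ = H.total globalSize +
        (globalSize (a ++ [.closing i]) + globalSize (.opening i :: b) + 1 : ℝ≥0) := by ring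
    _ ≤ _ := by gcongr

/-- Totals are real since weights are; a decrease by at least one survives the floor and gives an
integer potential. -/
lemma floor_lt_of_add_one_le {x y : ℝ≥0} (h : x + 1 ≤ y) : ⌊x⌋₊ < ⌊y⌋₊ := by
  have := Nat.floor_mono h
  rw [Nat.floor_add_one zero_le] at this
  omega

/-! ### Finitely branching terminating rules -/

/-- A rule all of whose choices are finite, and all of whose runs are finite. -/
structure IsTerminating {E : Type*} (β : E → Set E) (φ : E → ℕ) : Prop where
  lt : ∀ x, ∀ y ∈ β x, φ y < φ x
  finite : ∀ x, (β x).Finite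

/-- The states that can be produced by a rule. -/
def ruleReach {E : Type*} (β : E → Set E) (x : E) : Set E :=
  {y | Relation.ReflTransGen (fun x y => y ∈ β x) x y}

lemma IsTerminating.finite_ruleReach {E : Type*} {β : E → Set E} {φ : E → ℕ}
    (h : IsTerminating β φ) (x : E) : (ruleReach β x).Finite := by
  induction hn : φ x using Nat.strong_induction_on generalizing x with
  | _ n ih =>
    refine ((Set.finite_singleton x).union
      ((h.finite x).biUnion fun y hy => ih (φ y) (hn ▸ h.lt x y hy) y rfl)).subset ?_
    intro z hz
    rcases Relation.ReflTransGen.cases_head hz with rfl | ⟨y, hy, hz⟩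
    · exact .inl rfl
    · exact .inr (Set.mem_biUnion hy hz)

/-! ### Finite branching and termination of both rules -/

lemma MergeAt.left_unique {a b : List (Symb D)} {i : ℕ} {G₁ G₂ G : Grammar D}
    (h₁ : MergeAt a b i G₁ G) (h₂ : MergeAt a b i G₂ G) : G₁ = G₂ := by
  obtain ⟨h, H₁, rfl, e₁⟩ := h₁
  obtain ⟨_, H₂, rfl, e₂⟩ := h₂
  rw [add_right_cancel (e₁.symm.trans e₂)]

lemma MergeAt.right_unique {a b : List (Symb D)} {i : ℕ} {G G₁ G₂ : Grammar D}
    (h₁ : MergeAt a b i G G₁) (h₂ : MergeAt a b i G G₂) : G₁ = G₂ := by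
  obtain ⟨h, H₁, e₁, rfl⟩ := h₁
  obtain ⟨_, H₂, e₂, rfl⟩ := h₂
  rw [add_assoc] at e₁ e₂
  rw [add_right_cancel (e₁.symm.trans e₂)]

lemma MergeAt.weight_ne_zero {a b : List (Symb D)} {i : ℕ} {G G' : Grammar D}
    (h : MergeAt a b i G G') : G.weight (a ++ [.closing i]) ≠ 0 ∧
      G.weight (.opening i :: b) ≠ 0 ∧ G'.weight (a ++ b) ≠ 0 := by
  obtain ⟨h, H, rfl, rfl⟩ := h
  simp [unit_self]

/-- The two operands lie in the finite support of `G` and determine `a`, `b`, `i`, hence the result.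
-/
lemma finite_merge (G : Grammar D) : (merge G).Finite := by
  let f : List (Symb D) × List (Symb D) × ℕ → List (Symb D) × List (Symb D) :=
    fun p => (p.1 ++ [.closing p.2.2], .opening p.2.2 :: p.2.1)
  have hf : Function.Injective f := by
    rintro ⟨a, b, i⟩ ⟨a', b', i'⟩ h
    simp only [f, Prod.mk.injEq, List.cons.injEq, Symb.opening.injEq] at h
    obtain ⟨h1, rfl, rfl⟩ := h
    simp_all
  refine (((G.finite_support.prod G.finite_support).preimage hf.injOn).biUnion
    (t := fun p => {G' | MergeAt p.1 p.2.1 p.2.2 G G'}) fun p _ =>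
      Set.Subsingleton.finite fun _ h₁ _ h₂ => MergeAt.right_unique h₁ h₂).subset ?_
  intro G' hG'
  obtain ⟨a, b, i, h⟩ := mem_merge_iff.1 hG'
  exact Set.mem_biUnion (x := (a, b, i)) ⟨h.weight_ne_zero.1, h.weight_ne_zero.2.1⟩ h

/-- A split is determined by the whole, in the support of `G`, and by the right fragment, in the
support of `R`. Finiteness of the latter bounds the possible labels. -/
lemma finite_narrowParse (R G : Grammar D) : (narrowParse R G).Finite := by
  let f : List (Symb D) × List (Symb D) × ℕ → List (Symb D) × List (Symb D) :=
    fun p => (p.1 ++ p.2.1, .opening p.2.2 :: p.2.1)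
  have hf : Function.Injective f := by
    rintro ⟨a, b, i⟩ ⟨a', b', i'⟩ h
    simp only [f, Prod.mk.injEq, List.cons.injEq, Symb.opening.injEq] at h
    obtain ⟨h1, rfl, rfl⟩ := h
    simp_all
  refine (((G.finite_support.prod R.finite_support).preimage hf.injOn).biUnion
    (t := fun p => {G' | MergeAt p.1 p.2.1 p.2.2 G' G}) fun p _ =>
      Set.Subsingleton.finite fun _ h₁ _ h₂ => MergeAt.left_unique h₁ h₂).subset ?_
  intro G' hG'
  obtain ⟨a, b, i, h, -, hR⟩ := mem_narrowParse_iff.1 hG'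
  exact Set.mem_biUnion (x := (a, b, i)) ⟨h.weight_ne_zero.2.2, hR⟩ h

lemma isTerminating_merge :
    IsTerminating (merge (D := D)) (fun G => ⌊G.total (fun _ => 1)⌋₊) :=
  ⟨fun _ _ h => floor_lt_of_add_one_le (total_one_of_mem_merge h).ge, finite_merge⟩

lemma isTerminating_narrowParse (R : Grammar D) :
    IsTerminating (narrowParse R) (fun G => ⌊G.total globalSize⌋₊) :=
  ⟨fun _ _ h => floor_lt_of_add_one_le (total_globalSize_of_mem_narrowParse h),
    finite_narrowParse R⟩

/-! ### Texts -/

lemma merge_eq_empty_of_mem_texts {T : Grammar D} (hT : T ∈ texts D) : merge T = ∅ := by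
  refine Set.eq_empty_of_forall_notMem fun G' hG' => ?_
  obtain ⟨a, b, i, h⟩ := mem_merge_iff.1 hG'
  obtain ⟨w, -, hr⟩ := (hT _).2 h.weight_ne_zero.1
  have : Symb.closing i ∈ Symb.opening 0 :: w.map Symb.word := hr.perm.mem_iff.2 (by simp)
  simp at this

lemma numOpening_map_word (w : List D) : numOpening (w.map Symb.word) = 0 :=
  numOpening_eq_zero_of_isInner fun s hs => by
    obtain ⟨d, -, rfl⟩ := List.mem_map.1 hs
    trivial

lemma numWord_map_word (w : List D) : numWord (w.map Symb.word) = w.length := by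
  induction w with
  | nil => rfl
  | cons d w ih => simp [ih]

lemma isGlobal_of_mem_texts {T : Grammar D} (hT : T ∈ texts D) : IsGlobal T := by
  intro e he
  obtain ⟨w, -, hr⟩ := (hT e).2 he
  rw [← numOpeningZero_eq_of_isRotated hr]
  simp [numOpeningZero_eq_zero (numOpening_map_word w)]

lemma isCharged_of_mem_texts {R T : Grammar D} (hT : T ∈ texts D) : IsCharged R T := by
  intro e he hz
  have := isGlobal_of_mem_texts hT e he
  omega

/-- Removing a sentence from a nonempty text. -/
lemma exists_sentence_of_mem_texts {T : Grammar D} (hT : T ∈ texts D) (h0 : T ≠ 0) :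
    ∃ (w : List D) (hw : IsExpr (.opening 0 :: w.map Symb.word)) (H : Grammar D),
      w ≠ [] ∧ H ∈ texts D ∧ T = H + single _ hw := by
  obtain ⟨e, he⟩ : ∃ e, T.weight e ≠ 0 := by
    by_contra! h
    exact h0 (Grammar.ext (funext h))
  obtain ⟨w, hw0, hr⟩ := (hT e).2 he
  have hw := (T.isExpr_of_weight_ne_zero e he).congr hr.symm
  have h1 : 1 ≤ T.weight (.opening 0 :: w.map Symb.word) := by
    rw [T.weight_eq_of_isRotated _ _ hr]
    obtain ⟨n, hn⟩ := (hT e).1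
    rw [hn] at he ⊢
    exact_mod_cast Nat.one_le_iff_ne_zero.2 fun h => he (by simp [h])
  obtain ⟨H, rfl⟩ := exists_eq_add_single T hw h1
  refine ⟨w, hw, H, hw0, fun f => ⟨?_, fun hf => (hT f).2 (by simp [hf])⟩, rfl⟩
  obtain ⟨n, hn⟩ := (hT f).1
  by_cases hrf : (.opening 0 :: w.map Symb.word) ~r f
  · refine ⟨n - 1, ?_⟩
    simp only [weight_add, weight_single, Pi.add_apply, unit_of_isRotated hrf] at hn
    rw [Nat.cast_tsub, ← hn]
    simp
  · exact ⟨n, by simpa [unit_of_not_isRotated hrf] using hn⟩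

-- By induction on the number of words: a nonempty text is a smaller text plus one sentence, which
-- has bounded length over a finite dictionary.
open Classical in
lemma finite_texts_of_total_le [Finite D] (n : ℕ) :
    {T ∈ texts D | T.total numWord ≤ n}.Finite := by
  induction n with
  | zero =>
    refine (Set.finite_singleton 0).subset ?_
    rintro T ⟨hT, hn⟩
    by_contra h0
    obtain ⟨w, hw, H, hw0, hH, rfl⟩ := exists_sentence_of_mem_texts hT h0
    simp [total_add, total_single fun _ _ => numWord_eq_of_isRotated, numWord_map_word, hw0] at hn
  | succ n ih =>
    have := Fintype.ofFinite D
    let f : Grammar D → List D → Grammar D := fun H w =>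
      if hw : IsExpr (.opening 0 :: w.map Symb.word) then H + single _ hw else H
    refine ((Set.finite_singleton 0).union
      (Set.Finite.image2 f ih (List.finite_length_le D (n + 1)))).subset ?_
    rintro T ⟨hT, hn⟩
    by_cases h0 : T = 0
    · exact .inl h0
    right
    obtain ⟨w, hw, H, hw0, hH, rfl⟩ := exists_sentence_of_mem_texts hT h0
    rw [total_add, total_single fun _ _ => numWord_eq_of_isRotated] at hn
    simp only [numWord_cons_opening, numWord_map_word] at hn
    refine ⟨H, ⟨hH, ?_⟩, w, ?_, by simp [f, hw]⟩
    · have h1 : (1 : ℝ≥0) ≤ w.length := mod_cast List.length_pos_iff.2 hw0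
      push_cast at hn
      have : H.total numWord + 1 ≤ (n : ℝ≥0) + 1 := le_trans (by gcongr) hn
      exact le_of_add_le_add_right this
    · have h1 : (w.length : ℝ≥0) ≤ (n + 1 : ℕ) := le_trans (by simp) hn
      exact_mod_cast h1

lemma countable_texts [Finite D] : (texts D).Countable := by
  refine (Set.countable_iUnion fun n : ℕ =>
    (finite_texts_of_total_le (D := D) n).countable).mono fun T hT => ?_
  obtain ⟨n, hn⟩ := exists_nat_ge (T.total numWord)
  exact Set.mem_iUnion.2 ⟨n, hT, hn⟩

lemma total_numWord_of_narrowParse {R G G' : Grammar D}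
    (h : G' ∈ ruleReach (narrowParse R) G) :
    G.total numWord = G'.total numWord := by
  induction h with
  | refl => rfl
  | tail _ h ih => rw [ih, total_numWord_of_mem_merge (mem_merge_of_mem_narrowParse h)]

lemma total_numWord_of_merge {G G' : Grammar D}
    (h : G' ∈ ruleReach merge G) :
    G.total numWord = G'.total numWord := by
  induction h with
  | refl => rfl
  | tail _ h ih => rw [ih, total_numWord_of_mem_merge h]

/-! ### Finite communicating classes -/

section Recurrence

variable {E : Type*} {q : E → E → ℝ≥0∞}

open Classical in
/-- The probability that `y` is not visited at times `1, …, n`, starting from `x`. -/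
def avoidance (q : E → E → ℝ≥0∞) (y : E) : ℕ → E → ℝ≥0∞
  | 0 => fun _ => 1
  | n + 1 => fun x => ∑' z, if z = y then 0 else q x z * avoidance q y n z

/-- `C` is closed and has full mass for the kernel. -/
structure IsClosedClass (q : E → E → ℝ≥0∞) (C : Set E) : Prop where
  mem_of_pos : ∀ x ∈ C, ∀ y, 0 < q x y → y ∈ C
  tsum_eq_one : ∀ x ∈ C, ∑' y, q x y = 1

namespace IsClosedClass

variable {C : Set E} (hC : IsClosedClass q C)
include hC

lemma mul_congr {x z : E} (hx : x ∈ C) {a b : ℝ≥0∞} (h : z ∈ C → a = b) :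
    q x z * a = q x z * b := by
  by_cases hq : 0 < q x z
  · rw [h (hC.mem_of_pos x hx z hq)]
  · simp [nonpos_iff_eq_zero.1 (not_lt.1 hq)]

/-- Either `y` is avoided up to time `n`, or its first visit occurs at exactly one of the times 1 to
`n`. -/
lemma avoidance_add_sum (y : E) (n : ℕ) : ∀ x ∈ C,
    avoidance q y n x + ∑ m ∈ Finset.range n, firstPassage q m x y = 1 := by
  classical
  induction n with
  | zero => intro x _; simp [avoidance]
  | succ n ih =>
    intro x hx
    rw [Finset.sum_range_succ', ← add_assoc, avoidance]
    simp only [firstPassage]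
    rw [← Summable.tsum_finsetSum fun _ _ => ENNReal.summable, ← ENNReal.tsum_add,
      ← hC.tsum_eq_one x hx]
    have : q x y = ∑' z, if z = y then q x z else 0 := by rw [tsum_ite_eq]
    conv_lhs => rw [this]
    rw [← ENNReal.tsum_add]
    refine tsum_congr fun z => ?_
    by_cases hz : z = y
    · simp [hz]
    · simp only [hz, if_false, add_zero, ← Finset.mul_sum, ← mul_add]
      rw [hC.mul_congr hx (ih z), mul_one]

lemma avoidance_le_one (y : E) (n : ℕ) {x : E} (hx : x ∈ C) : avoidance q y n x ≤ 1 :=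
  (hC.avoidance_add_sum y n x hx).symm ▸ le_self_add

/-- After `n` steps the chain is still in `C`, where avoiding `y` for `m` more steps costs a factor
at most `ρ`. -/
lemma avoidance_add_le {y : E} {m : ℕ} {ρ : ℝ≥0∞} (hρ : ∀ x ∈ C, avoidance q y m x ≤ ρ)
    (n : ℕ) : ∀ x ∈ C, avoidance q y (n + m) x ≤ ρ * avoidance q y n x := by
  classical
  induction n with
  | zero => intro x hx; simpa [avoidance] using hρ x hx
  | succ n ih =>
    intro x hx
    rw [Nat.add_right_comm, avoidance, avoidance, ← ENNReal.tsum_mul_left]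
    refine ENNReal.tsum_le_tsum fun z => ?_
    by_cases hz : z = y
    · simp [hz]
    · simp only [hz, if_false]
      rw [mul_left_comm]
      by_cases hq : 0 < q x z
      · gcongr
        exact ih z (hC.mem_of_pos x hx z hq)
      · simp [nonpos_iff_eq_zero.1 (not_lt.1 hq)]

end IsClosedClass

/-! ### Paths of positive probability and positive recurrence -/

lemma exists_pos_of_compKernel_pos {k l : E → E → ℝ≥0∞} {x y : E} :
    0 < compKernel k l x y ↔ ∃ z, 0 < k x z ∧ 0 < l z y := by
  simp only [compKernel, pos_iff_ne_zero, ne_eq, ENNReal.tsum_eq_zero, not_forall, mul_eq_zero,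
    not_or]

lemma exists_firstPassage_pos {x y : E} (n : ℕ) (h : 0 < iterKernel q (n + 1) x y) :
    ∃ m, 0 < firstPassage q m x y := by
  classical
  induction n generalizing x with
  | zero =>
    obtain ⟨z, h1, h2⟩ := exists_pos_of_compKernel_pos.1 h
    by_cases hz : z = y
    · exact ⟨0, by simpa [firstPassage, ← hz] using h1⟩
    · simp [iterKernel, hz] at h2
  | succ n ih =>
    obtain ⟨z, h1, h2⟩ := exists_pos_of_compKernel_pos.1 h
    by_cases hz : z = y
    · exact ⟨0, by simpa [firstPassage, ← hz] using h1⟩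
    obtain ⟨m, hm⟩ := ih h2
    refine ⟨m + 1, ?_⟩
    rw [firstPassage]
    refine lt_of_lt_of_le ?_ (ENNReal.le_tsum z)
    simp [hz, ENNReal.mul_pos h1.ne' hm.ne']

lemma mem_reachable_self (x : E) : x ∈ reachable q x := ⟨0, by simp [iterKernel]⟩

lemma mem_reachable_iff {x y : E} :
    y ∈ reachable q x ↔ Relation.ReflTransGen (fun x y => 0 < q x y) x y := by
  constructor
  · rintro ⟨n, hn⟩
    induction n generalizing x with
    | zero =>
      have : x = y := by by_contra h; simp [iterKernel, h] at hn
      rw [this]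
    | succ n ih =>
      obtain ⟨z, h1, h2⟩ := exists_pos_of_compKernel_pos.1 hn
      exact .head h1 (ih h2)
  · intro h
    induction h using Relation.ReflTransGen.head_induction_on with
    | refl => exact mem_reachable_self y
    | head h1 _ ih =>
      obtain ⟨n, hn⟩ := ih
      exact ⟨n + 1, exists_pos_of_compKernel_pos.2 ⟨_, h1, hn⟩⟩

/-- In a finite closed class all of whose states lead to `y`, the state `y` is positive
recurrent. -/
lemma IsClosedClass.isPositiveRecurrent {C : Set E} (hC : IsClosedClass q C) (hfin : C.Finite)
    {y : E} (hy : y ∈ C) (hreach : ∀ x ∈ C, y ∈ reachable q x) : IsPositiveRecurrent q y := by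
  classical
  -- A path of zero steps does not count as a return, so one step of positive probability, which
  -- exists by full mass, is taken before `y` is reached.
  have h1 : ∀ x ∈ C, ∃ m, 0 < firstPassage q m x y := by
    intro x hx
    obtain ⟨z, hz⟩ : ∃ z, 0 < q x z := by
      by_contra! h
      have := hC.tsum_eq_one x hx
      simp [fun z => nonpos_iff_eq_zero.1 (h z)] at this
    obtain ⟨n, hn⟩ := hreach z (hC.mem_of_pos x hx z hz)
    exact exists_firstPassage_pos n (exists_pos_of_compKernel_pos.2 ⟨z, hz, hn⟩)
  choose! m hm using h1
  obtain ⟨N, hN⟩ : ∃ N, ∀ x ∈ C, m x < N := by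
    obtain ⟨N, hN⟩ := (hfin.image m).bddAbove
    exact ⟨N + 1, fun x hx => Nat.lt_succ_of_le (hN ⟨x, hx, rfl⟩)⟩
  have h2 : ∀ x ∈ C, avoidance q y N x < 1 := by
    intro x hx
    refine lt_of_le_of_ne (hC.avoidance_le_one y N hx) fun h => ?_
    have h3 := hC.avoidance_add_sum y N x hx
    rw [h] at h3
    have h4 : ∑ m ∈ Finset.range N, firstPassage q m x y = 0 := by
      have h5 : (1 : ℝ≥0∞) + ∑ m ∈ Finset.range N, firstPassage q m x y = 1 + 0 := by
        simpa using h3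
      exact (ENNReal.add_right_inj ENNReal.one_ne_top).1 h5
    exact (hm x hx).ne' (Finset.sum_eq_zero_iff.1 h4 _ (Finset.mem_range.2 (hN x hx)))
  -- Finiteness of the class gives a uniform bound below 1 on the probability of avoiding `y` for
  -- `N` steps.
  obtain ⟨x₀, hx₀, hmax⟩ := hfin.exists_maximalFor (avoidance q y N) C ⟨y, hy⟩
  set ρ := avoidance q y N x₀ with hρ
  have hρ1 : ρ < 1 := h2 x₀ hx₀
  have hle : ∀ x ∈ C, avoidance q y N x ≤ ρ := fun x hx => by
    rcases le_total (avoidance q y N x) ρ with h | h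
    · exact h
    · exact hmax hx h
  set r : ℕ → ℝ≥0∞ := fun n => avoidance q y n y with hr
  have hr1 : ∀ n, r n ≤ 1 := fun n => hC.avoidance_le_one y n hy
  have hsum : ∀ n, ∑ k ∈ Finset.range n, r k ≤ N / (1 - ρ) := by
    intro n
    -- Bound the first `N` terms by 1 and the following ones by `ρ` times the terms `N` places
    -- earlier. The partial sums being finite, this can be solved for them.
    have hA : ∑ k ∈ Finset.range n, r k ≤ N + ρ * ∑ k ∈ Finset.range n, r k := by
      calc _ ≤ ∑ k ∈ Finset.range (N + n), r k :=
            Finset.sum_le_sum_of_subset (Finset.range_mono (by omega))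
        _ = ∑ k ∈ Finset.range N, r k + ∑ k ∈ Finset.range n, r (N + k) :=
            Finset.sum_range_add _ _ _
        _ ≤ ∑ k ∈ Finset.range N, 1 + ∑ k ∈ Finset.range n, ρ * r k := by
            gcongr with k _ k _
            · exact hr1 k
            · rw [add_comm]; exact hC.avoidance_add_le hle k y hy
        _ = _ := by simp [Finset.mul_sum]
    have hfinite : ∑ k ∈ Finset.range n, r k ≠ ∞ :=
      (ENNReal.sum_lt_top.2 fun k _ => (hr1 k).trans_lt ENNReal.one_lt_top).ne
    have hρ0 : (1 - ρ) ≠ 0 := (tsub_pos_of_lt hρ1).ne'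
    rw [ENNReal.le_div_iff_mul_le (.inl hρ0) (.inl (by simp)), mul_comm,
      ENNReal.sub_mul (fun _ _ => hfinite), one_mul]
    exact tsub_le_iff_right.2 hA
  have htsum : ∑' k, r k ≠ ∞ := by
    refine ne_top_of_le_ne_top (b := N / (1 - ρ)) ?_ ?_
    · exact ENNReal.div_ne_top (by simp) (tsub_pos_of_lt hρ1).ne'
    · rw [ENNReal.tsum_eq_iSup_nat]
      exact iSup_le hsum
  have hr0 : Filter.Tendsto r Filter.atTop (nhds 0) :=
    ENNReal.tendsto_atTop_zero_of_tsum_ne_top htsum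
  set f : ℕ → ℝ≥0∞ := fun n => firstPassage q n y y with hf
  have hadd : ∀ n, r n + ∑ k ∈ Finset.range n, f k = 1 := fun n => hC.avoidance_add_sum y n y hy
  have hrf : ∀ n, f n + r (n + 1) = r n := by
    intro n
    have h3 := (hadd (n + 1)).trans (hadd n).symm
    rw [Finset.sum_range_succ, add_comm (∑ k ∈ Finset.range n, f k), ← add_assoc] at h3
    rw [add_comm]
    refine (ENNReal.add_left_inj (ne_top_of_le_ne_top ENNReal.one_ne_top ?_)).1 h3
    exact (hadd n) ▸ le_add_self
  refine ⟨?_, ?_⟩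
  · have h3 : Filter.Tendsto (fun n => r n + ∑ k ∈ Finset.range n, f k) Filter.atTop
        (nhds (0 + ∑' k, f k)) := hr0.add ENNReal.summable.hasSum.tendsto_sum_nat
    simp only [hadd, zero_add] at h3
    exact (tendsto_nhds_unique tendsto_const_nhds h3).symm
  -- Summation by parts: the expected return time is the sum of the probabilities of avoiding `y`.
  · have h3 : ∀ K : ℕ, ∑ n ∈ Finset.range K, ((n + 1 : ℕ) : ℝ≥0∞) * f n + K * r K =
        ∑ n ∈ Finset.range K, r n := by
      intro K
      induction K with
      | zero => simp
      | succ K ih =>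
        rw [Finset.sum_range_succ, Finset.sum_range_succ, ← ih, ← hrf K]
        push_cast
        ring
    refine lt_of_le_of_lt ?_ htsum.lt_top
    rw [ENNReal.tsum_eq_iSup_nat]
    exact iSup_le fun K => le_trans (le_self_add.trans (h3 K).le) (ENNReal.sum_le_tsum _)

/-- A weakly reversible kernel with finite reachable sets splits into finite positive recurrent
classes. -/
lemma splitsIntoFinitePositiveRecurrentClasses {X : Set E} (hX : IsClosedClass q X)
    (hsymm : ∀ x ∈ X, ∀ y ∈ X, 0 < q x y ↔ 0 < q y x)
    (hfin : ∀ x ∈ X, (reachable q x).Finite) :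
    SplitsIntoFinitePositiveRecurrentClasses q X := by
  -- Each edge of a path can be reversed inside `X`, so reachability is symmetric and the
  -- communicating classes are the reachable sets.
  have hmem : ∀ x ∈ X, ∀ y ∈ reachable q x, y ∈ X ∧ x ∈ reachable q y := by
    intro x hx y hy
    rw [mem_reachable_iff] at hy ⊢
    induction hy with
    | refl => exact ⟨hx, .refl⟩
    | tail _ h ih =>
      have h' := hX.mem_of_pos _ ih.1 _ h
      exact ⟨h', .head ((hsymm _ ih.1 _ h').1 h) ih.2⟩
  have hclass : ∀ x ∈ X, communicatingClass q x = reachable q x := fun x hx =>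
    Set.ext fun y => ⟨fun h => h.1, fun h => ⟨h, (hmem x hx y h).2⟩⟩
  have htrans : ∀ {x y z : E}, y ∈ reachable q x → z ∈ reachable q y → z ∈ reachable q x := by
    intro x y z h1 h2
    rw [mem_reachable_iff] at *
    exact h1.trans h2
  have heq : ∀ x ∈ X, ∀ y ∈ reachable q x, reachable q y = reachable q x := fun x hx y hy =>
    Set.ext fun z => ⟨fun h => htrans hy h, fun h => htrans (hmem x hx y hy).2 h⟩
  refine ⟨reachable q '' X, ?_, ?_, ?_⟩
  · ext y
    simp only [Set.sUnion_image, Set.mem_iUnion, exists_prop]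
    exact ⟨fun ⟨x, hx, hy⟩ => (hmem x hx y hy).1, fun hy => ⟨y, hy, mem_reachable_self y⟩⟩
  · rintro _ ⟨x, hx, rfl⟩ _ ⟨y, hy, rfl⟩ hxy
    refine Set.disjoint_left.2 fun z hz hz' => hxy ?_
    rw [← heq x hx z hz, ← heq y hy z hz']
  · rintro _ ⟨x, hx, rfl⟩
    refine ⟨⟨x, mem_reachable_self x⟩, hfin x hx, fun y hy => ?_⟩
    have hyX := (hmem x hx y hy).1
    have hcl : IsClosedClass q (reachable q x) :=
      ⟨fun y hy z hz => htrans hy (mem_reachable_iff.2 (.single hz)),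
        fun y hy => hX.tsum_eq_one y (hmem x hx y hy).1⟩
    refine ⟨by rw [hclass y hyX, heq x hx y hy], hcl.mem_of_pos y hy, ?_,
      hcl.isPositiveRecurrent (hfin x hx) hy fun z hz => htrans (hmem x hx z hz).2 hy⟩
    rw [← hX.tsum_eq_one y hyX]
    exact tsum_subtype_eq_of_support_subset fun z hz =>
      hcl.mem_of_pos y hy z (pos_iff_ne_zero.2 hz)

end Recurrence

/-! ### Markov chains supported by countable sets -/

section Markov

variable {E : Type*} {Ω : Type*} [MeasurableSpace Ω] {μ : Measure Ω}

/-- Decomposition of an event along the values of a discrete random variable. -/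
lemma measure_eq_tsum_fiber {F : Type*} {Y : Ω → F} {S : Set F} (hS : S.Countable) {A : Set Ω}
    (hA : ∀ᵐ ω ∂μ, ω ∈ A → Y ω ∈ S) (hm : ∀ y ∈ S, MeasurableSet {ω | Y ω = y ∧ ω ∈ A}) :
    μ A = ∑' y : S, μ {ω | Y ω = y ∧ ω ∈ A} := by
  rw [← measure_biUnion hS (f := fun y => {ω | Y ω = y ∧ ω ∈ A}) ?_ hm]
  · refine measure_congr ?_
    filter_upwards [hA] with ω hω
    refine propext ⟨fun h => Set.mem_biUnion (hω h) ⟨rfl, h⟩, fun h => ?_⟩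
    obtain ⟨y, -, hy⟩ := Set.mem_iUnion₂.1 h
    exact hy.2
  · intro y _ z _ hyz
    exact Set.disjoint_left.2 fun ω h1 h2 => hyz (h1.1.symm.trans h2.1)

namespace IsMarkovChain

variable {X : ℕ → Ω → E} {k : ℕ → E → E → ℝ≥0∞} (hX : IsMarkovChain μ X k)
include hX

lemma measurableSet_mem (n : ℕ) (A : Set E) : MeasurableSet {ω | X n ω ∈ A} :=
  @hX.1 n A trivial

lemma measurableSet_eq (n : ℕ) (x : E) : MeasurableSet {ω | X n ω = x} :=
  hX.measurableSet_mem n {x}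

lemma measurableSet_box (n : ℕ) (A : ℕ → Set E) : MeasurableSet {ω | ∀ i < n, X i ω ∈ A i} := by
  simp only [Set.ofPred_forall]
  exact MeasurableSet.iInter fun i => MeasurableSet.iInter fun _ => hX.measurableSet_mem i _

/-- The Markov property, with respect to events of the past that are products. -/
lemma measure_box {C : Set E} (hC : C.Countable) {n : ℕ}
    (hXC : ∀ i < n, ∀ᵐ ω ∂μ, X i ω ∈ C) (A : ℕ → Set E) (x y : E) :
    μ {ω | (∀ i < n, X i ω ∈ A i) ∧ X n ω = x ∧ X (n + 1) ω = y} =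
      μ {ω | (∀ i < n, X i ω ∈ A i) ∧ X n ω = x} * k n x y := by
  -- The definition of a chain only speaks of fully specified histories; the event is summed over
  -- the countably many histories that lie in the box.
  set Y : Ω → Fin n → E := fun ω i => X i ω
  set S : Set (Fin n → E) := {h | (∀ i, h i ∈ C) ∧ ∀ i : Fin n, h i ∈ A i} with hSdef
  have hS : S.Countable :=
    (Set.countable_univ_pi (s := fun _ : Fin n => C) fun _ => hC).mono
      fun h hh => Set.mem_univ_pi.2 hh.1
  have hYS : ∀ᵐ ω ∂μ, (∀ i < n, X i ω ∈ A i) → Y ω ∈ S := by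
    have : ∀ᵐ ω ∂μ, ∀ i : Fin n, X i ω ∈ C := ae_all_iff.2 fun i => hXC i i.2
    filter_upwards [this] with ω h1 h2 using ⟨h1, fun i => h2 i i.2⟩
  have hYm : ∀ h, MeasurableSet {ω | Y ω = h} := fun h => by
    simp only [Y, funext_iff, Set.ofPred_forall]
    exact MeasurableSet.iInter fun i => hX.measurableSet_eq i _
  have hbox := hX.measurableSet_box n A
  rw [measure_eq_tsum_fiber (μ := μ) (Y := Y) hS
    (A := {ω | (∀ i < n, X i ω ∈ A i) ∧ X n ω = x ∧ X (n + 1) ω = y})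
    (by filter_upwards [hYS] with ω h1 h2 using h1 h2.1)
    (fun h _ => (hYm h).inter (hbox.inter ((hX.measurableSet_eq n x).inter
      (hX.measurableSet_eq (n + 1) y)))),
    measure_eq_tsum_fiber (μ := μ) (Y := Y) hS
    (A := {ω | (∀ i < n, X i ω ∈ A i) ∧ X n ω = x})
    (by filter_upwards [hYS] with ω h1 h2 using h1 h2.1)
    (fun h _ => (hYm h).inter (hbox.inter (hX.measurableSet_eq n x))), ← ENNReal.tsum_mul_right]
  refine tsum_congr fun ⟨h, hh⟩ => ?_
  set z : ℕ → E := fun i => if hi : i < n then h ⟨i, hi⟩ else if i = n then x else y with hz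
  have hz1 : ∀ i (hi : i < n), z i = h ⟨i, hi⟩ := fun i hi => by simp [hz, hi]
  have hz2 : z n = x := by simp [hz]
  have hz3 : z (n + 1) = y := by simp [hz]
  have key := hX.2 n z
  rw [hz2, hz3] at key
  have hY : ∀ ω, Y ω = h ↔ ∀ i < n, X i ω = z i := fun ω => by
    simp only [Y, funext_iff]
    exact ⟨fun h' i hi => by rw [hz1 i hi, ← h' ⟨i, hi⟩],
      fun h' i => by rw [h' i i.2, hz1 i i.2]⟩
  have hA : ∀ ω, (∀ i < n, X i ω = z i) → ∀ i < n, X i ω ∈ A i := fun ω h' i hi => by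
    rw [h' i hi, hz1 i hi]; exact hh.2 ⟨i, hi⟩
  convert key using 3
  · ext ω
    simp only [Set.mem_ofPred_eq, hY]
    constructor
    · rintro ⟨h1, -, h2, h3⟩ i hi
      rcases Nat.lt_or_ge i n with h4 | h4
      · exact h1 i h4
      · obtain rfl | rfl : i = n ∨ i = n + 1 := by omega
        · rw [h2, hz2]
        · rw [h3, hz3]
    · intro h1
      have h2 : ∀ i < n, X i ω = z i := fun i hi => h1 i (by omega)
      exact ⟨h2, hA ω h2, by rw [h1 n (by omega), hz2], by rw [h1 (n + 1) le_rfl, hz3]⟩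
  · ext ω
    simp only [Set.mem_ofPred_eq, hY]
    constructor
    · rintro ⟨h1, -, h2⟩ i hi
      rcases Nat.lt_or_ge i n with h4 | h4
      · exact h1 i h4
      · obtain rfl : i = n := by omega
        rw [h2, hz2]
    · intro h1
      have h2 : ∀ i < n, X i ω = z i := fun i hi => h1 i (by omega)
      exact ⟨h2, hA ω h2, by rw [h1 n le_rfl, hz2]⟩

lemma measure_pair {C : Set E} (hC : C.Countable) {n : ℕ}
    (hXC : ∀ i < n, ∀ᵐ ω ∂μ, X i ω ∈ C) (x y : E) :
    μ {ω | X n ω = x ∧ X (n + 1) ω = y} = μ {ω | X n ω = x} * k n x y := by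
  simpa using hX.measure_box hC hXC (fun _ => Set.univ) x y

/-- A Markov chain does not leave a family of countable sets of full mass. -/
lemma ae_mem [IsProbabilityMeasure μ] {C : ℕ → Set E} (hC : ∀ n, (C n).Countable)
    (h0 : ∀ᵐ ω ∂μ, X 0 ω ∈ C 0) (hk : ∀ n, ∀ x ∈ C n, ∑' y : C (n + 1), k n x y = 1) (n : ℕ) :
    ∀ᵐ ω ∂μ, X n ω ∈ C n := by
  -- Summing over histories needs countable support at all earlier times, not only at the previous
  -- one.
  induction n using Nat.strong_induction_on with
  | _ n ih =>
    cases n with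
    | zero => exact h0
    | succ n =>
      have hn := ih n n.lt_succ_self
      have hpair := hX.measure_pair (n := n) (Set.countable_iUnion hC) (fun i hi => by
        filter_upwards [ih i (by omega)] with ω h using Set.mem_iUnion.2 ⟨i, h⟩)
      refine (mem_ae_iff_prob_eq_one (hX.measurableSet_mem (n + 1) (C (n + 1)))).2 ?_
      have h1 : μ Set.univ = ∑' x : C n, μ {ω | X n ω = x} := by
        rw [measure_eq_tsum_fiber (Y := X n) (hC n) (A := Set.univ)
          (by filter_upwards [hn] with ω h _ using h)
          (fun x _ => (hX.measurableSet_eq n x).inter .univ)]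
        simp
      rw [← measure_univ (μ := μ), h1, measure_eq_tsum_fiber (Y := X n) (hC n)
        (A := {ω | X (n + 1) ω ∈ C (n + 1)})
        (by filter_upwards [hn] with ω h _ using h)
        (fun x _ => (hX.measurableSet_eq n x).inter (hX.measurableSet_mem _ _))]
      refine tsum_congr fun ⟨x, hx⟩ => ?_
      change μ {ω | X n ω = x ∧ X (n + 1) ω ∈ C (n + 1)} = μ {ω | X n ω = x}
      rw [measure_eq_tsum_fiber (Y := X (n + 1)) (hC (n + 1))
        (A := {ω | X n ω = x ∧ X (n + 1) ω ∈ C (n + 1)})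
        (by filter_upwards with ω h using h.2)
        (fun y _ => (hX.measurableSet_eq _ y).inter
          ((hX.measurableSet_eq n x).inter (hX.measurableSet_mem _ _)))]
      conv_rhs => rw [← mul_one (μ _), ← hk n x hx, ← ENNReal.tsum_mul_left]
      refine tsum_congr fun ⟨y, hy⟩ => ?_
      rw [← hpair]
      congr 1
      ext ω
      simp only [Set.mem_ofPred_eq]
      exact ⟨fun h => ⟨h.2.1, h.1⟩, fun h => ⟨h.2, h.1, h.2 ▸ hy⟩⟩

/-- Almost surely, the transitions have a positive probability. -/
lemma ae_pos {C : Set E} (hC : C.Countable) (hXC : ∀ i, ∀ᵐ ω ∂μ, X i ω ∈ C) (n : ℕ) :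
    ∀ᵐ ω ∂μ, 0 < k n (X n ω) (X (n + 1) ω) := by
  have h1 : ∀ᵐ ω ∂μ, ∀ x ∈ C, ∀ y ∈ C, k n x y = 0 → ¬ (X n ω = x ∧ X (n + 1) ω = y) := by
    refine (ae_ball_iff hC).2 fun x _ => (ae_ball_iff hC).2 fun y _ => ?_
    by_cases hk : k n x y = 0
    · have := hX.measure_pair (n := n) hC (fun i _ => hXC i) x y
      rw [hk, mul_zero] at this
      have h2 : ∀ᵐ ω ∂μ, ¬ (X n ω = x ∧ X (n + 1) ω = y) := by
        rw [ae_iff]; simpa using this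
      filter_upwards [h2] with ω h _ using h
    · exact Filter.Eventually.of_forall fun ω h => absurd h hk
  filter_upwards [h1, hXC n, hXC (n + 1)] with ω h2 h3 h4
  exact pos_iff_ne_zero.2 fun h => h2 _ h3 _ h4 h ⟨rfl, rfl⟩

/-- Two consecutive transitions. -/
lemma measure_box_two {C : Set E} (hC : C.Countable) (hXC : ∀ i, ∀ᵐ ω ∂μ, X i ω ∈ C)
    (n : ℕ) (A : ℕ → Set E) (x y : E) :
    μ {ω | (∀ i < n, X i ω ∈ A i) ∧ X n ω = x ∧ X (n + 2) ω = y} =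
      μ {ω | (∀ i < n, X i ω ∈ A i) ∧ X n ω = x} * ∑' z : C, k n x z * k (n + 1) z y := by
  classical
  rw [measure_eq_tsum_fiber (Y := X (n + 1)) hC
      (A := {ω | (∀ i < n, X i ω ∈ A i) ∧ X n ω = x ∧ X (n + 2) ω = y})
      (by filter_upwards [hXC (n + 1)] with ω h _ using h)
      (fun z _ => (hX.measurableSet_eq _ z).inter ((hX.measurableSet_box n A).inter
        ((hX.measurableSet_eq n x).inter (hX.measurableSet_eq _ y)))),
    ← ENNReal.tsum_mul_left]
  refine tsum_congr fun ⟨z, hz⟩ => ?_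
  rw [← mul_assoc, ← hX.measure_box hC (fun i _ => hXC i)]
  -- The condition at time `n` is absorbed into the box, so that the second transition is again an
  -- instance of `measure_box`.
  set B : ℕ → Set E := Function.update A n {x} with hB
  have hBA : ∀ ω, (∀ i < n + 1, X i ω ∈ B i) ↔ (∀ i < n, X i ω ∈ A i) ∧ X n ω = x := by
    intro ω
    constructor
    · intro h
      refine ⟨fun i hi => ?_, by simpa [hB] using h n (by omega)⟩
      simpa [hB, Function.update_of_ne (show i ≠ n by omega)] using h i (by omega)
    · rintro ⟨h1, h2⟩ i hi
      rcases eq_or_ne i n with rfl | hin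
      · simp [hB, h2]
      · simpa [hB, Function.update_of_ne hin] using h1 i (by omega)
  have := hX.measure_box (n := n + 1) hC (fun i _ => hXC i) B z y
  simp only [hBA] at this
  convert this using 3
  · ext ω
    simp only [Set.mem_ofPred_eq]
    tauto
  · ext ω
    simp only [Set.mem_ofPred_eq]
    tauto

end IsMarkovChain

end Markov

/-! ### Stopped Markov chains driven by terminating rules -/

namespace StoppedMarkovChain

variable {E : Type*} {β : E → Set E} {Ω : Type*} [MeasurableSpace Ω]
  (S : StoppedMarkovChain E β Ω)

lemma stoppingTime_eq_iff (ω : Ω) (n : ℕ) :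
    S.stoppingTime ω = n ↔ β (S.path n ω) = ∅ ∧ ∀ m < n, β (S.path m ω) ≠ ∅ := by
  have hle : ∀ m, β (S.path m ω) = ∅ → S.stoppingTime ω ≤ m := fun m hm => iInf₂_le m hm
  have hex : S.stoppingTime ω = n → ∃ m ≤ n, β (S.path m ω) = ∅ := by
    intro h
    by_contra! h'
    have : ((n + 1 : ℕ) : ℕ∞) ≤ S.stoppingTime ω := le_iInf₂ fun m hm => by
      have : ¬ m ≤ n := fun hmn => (h' m hmn).ne_empty hm
      exact_mod_cast (by omega : n + 1 ≤ m)
    rw [h] at this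
    exact absurd (Nat.cast_le.1 this) (by omega)
  constructor
  · intro h
    have hlt : ∀ m < n, β (S.path m ω) ≠ ∅ := fun m hm h' => by
      have := hle m h'
      rw [h] at this
      exact absurd (Nat.cast_le.1 this) (by omega)
    obtain ⟨m, hmn, hm⟩ := hex h
    rcases hmn.eq_or_lt with rfl | hmn
    · exact ⟨hm, hlt⟩
    · exact absurd hm (hlt m hmn)
  · rintro ⟨h1, h2⟩
    refine le_antisymm (hle n h1) (le_iInf₂ fun m hm => ?_)
    have : ¬ m < n := fun hmn => h2 m hmn hm
    exact_mod_cast (by omega : n ≤ m)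

/-- Measurability does not depend on the law; the starting point `x₀` only selects one of the Markov
chains from which it is read. -/
lemma measurableSet_path (x₀ : E) (n : ℕ) (A : Set E) : MeasurableSet {ω | S.path n ω ∈ A} :=
  (S.markov x₀).measurableSet_mem n A

lemma measurableSet_outputIn (x₀ : E) (A : Set E) : MeasurableSet (S.outputIn A) := by
  have : S.outputIn A = ⋃ n : ℕ, {ω | S.path n ω ∈ {y | β y = ∅}} ∩
      (⋂ m : ℕ, ⋂ _ : m < n, {ω | S.path m ω ∈ {y | β y ≠ ∅}}) ∩ {ω | S.path n ω ∈ A} := by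
    ext ω
    simp [outputIn, stoppingTime_eq_iff]
  rw [this]
  exact MeasurableSet.iUnion fun n => ((S.measurableSet_path x₀ n _).inter
    (MeasurableSet.iInter fun m => MeasurableSet.iInter fun _ =>
      S.measurableSet_path x₀ m _)).inter (S.measurableSet_path x₀ n A)

lemma mem_of_mem_outputIn {A : Set E} {ω : Ω} {n : ℕ} (h : S.stoppingTime ω = n)
    (hA : ω ∈ S.outputIn A) : S.path n ω ∈ A := by
  obtain ⟨m, h1, h2⟩ := hA
  rw [h, Nat.cast_inj] at h1
  exact h1 ▸ h2

lemma outputIn_inter (A B : Set E) : S.outputIn A ∩ S.outputIn B = S.outputIn (A ∩ B) := by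
  ext ω
  constructor
  · rintro ⟨⟨n, h1, h2⟩, hB⟩
    exact ⟨n, h1, h2, S.mem_of_mem_outputIn h1 hB⟩
  · rintro ⟨n, h1, h2, h3⟩
    exact ⟨⟨n, h1, h2⟩, ⟨n, h1, h3⟩⟩

lemma outputIn_empty : S.outputIn ∅ = ∅ := by
  ext ω
  simp [outputIn]

lemma mem_of_step_pos {x y : E} (hx : β x ≠ ∅) (h : 0 < S.step x y) : y ∈ β x :=
  (S.step_pos_iff x hx y).1 h

variable {φ : E → ℕ} (hβ : IsTerminating β φ)
include hβ

lemma ae_path_mem (x : E) (n : ℕ) : ∀ᵐ ω ∂(S.law x), S.path n ω ∈ ruleReach β x := by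
  have := S.isProbabilityMeasure x
  refine (S.markov x).ae_mem (C := fun _ => ruleReach β x)
    (fun _ => (hβ.finite_ruleReach x).countable) ?_ ?_ n
  · filter_upwards [S.start x] with ω h
    rw [h]
    exact Relation.ReflTransGen.refl
  · intro _ y hy
    rw [← (S.step y).tsum_coe]
    refine tsum_subtype_eq_of_support_subset fun z hz => ?_
    by_cases h : β y = ∅
    · rw [S.step_of_stopped y h] at hz
      have : z = y := by by_contra h'; simp [h'] at hz
      rwa [this]
    · exact Relation.ReflTransGen.tail hy (S.mem_of_step_pos h (pos_iff_ne_zero.2 hz))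

lemma ae_path_step (x : E) :
    ∀ᵐ ω ∂(S.law x), ∀ n, β (S.path n ω) ≠ ∅ → S.path (n + 1) ω ∈ β (S.path n ω) := by
  refine ae_all_iff.2 fun n => ?_
  filter_upwards [(S.markov x).ae_pos (hβ.finite_ruleReach x).countable (S.ae_path_mem hβ x) n]
    with ω h h' using S.mem_of_step_pos h' h

lemma ae_mem_outputIn (x : E) : ∀ᵐ ω ∂(S.law x), ∃ y ∈ ruleReach β x, ω ∈ S.outputIn {y} := by
  classical
  filter_upwards [S.ae_path_step hβ x, ae_all_iff.2 (S.ae_path_mem hβ x)] with ω h1 h2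
  have hex : ∃ n, β (S.path n ω) = ∅ := by
    by_contra! h
    -- The potential drops by at least one per step, which is impossible beyond its initial value.
    have hlt : ∀ n, φ (S.path n ω) + n ≤ φ (S.path 0 ω) := by
      intro n
      induction n with
      | zero => simp
      | succ n ih =>
        have := hβ.lt _ _ (h1 n (h n).ne_empty)
        omega
    have := hlt (φ (S.path 0 ω) + 1)
    omega
  exact ⟨S.path (Nat.find hex) ω, h2 _, Nat.find hex,
    (S.stoppingTime_eq_iff ω _).2 ⟨Nat.find_spec hex, fun m hm => Nat.find_min hex hm⟩, rfl⟩

/-- The output almost surely lies in the finite set of reachable states, so additivity applies even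
if `A` is uncountable. -/
lemma law_outputIn_eq_tsum (x : E) (A : Set E) :
    S.law x (S.outputIn A) = ∑' y : A, S.outputProb x y := by
  have h1 : S.law x (S.outputIn A) =
      S.law x (⋃ y ∈ ruleReach β x, S.outputIn A ∩ S.outputIn {y}) := by
    refine measure_congr ?_
    filter_upwards [S.ae_mem_outputIn hβ x] with ω ⟨y, hy, hω⟩
    refine propext ⟨fun h => Set.mem_biUnion hy ⟨h, hω⟩, fun h => ?_⟩
    obtain ⟨z, -, hz⟩ := Set.mem_iUnion₂.1 h
    exact hz.1
  rw [h1, measure_biUnion (hβ.finite_ruleReach x).countable]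
  · rw [tsum_subtype (ruleReach β x) fun y => S.law x (S.outputIn A ∩ S.outputIn {y}),
      tsum_subtype A fun y => S.outputProb x y]
    refine tsum_congr fun y => ?_
    by_cases hyA : y ∈ A
    · rw [Set.indicator_of_mem hyA]
      by_cases hy : y ∈ ruleReach β x
      · rw [Set.indicator_of_mem hy, outputIn_inter,
          Set.inter_eq_right.2 (Set.singleton_subset_iff.2 hyA)]
        rfl
      · rw [Set.indicator_of_notMem hy]
        symm
        refine measure_mono_null (t := {ω | ¬ ∃ y ∈ ruleReach β x, ω ∈ S.outputIn {y}}) ?_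
          (ae_iff.1 (S.ae_mem_outputIn hβ x))
        rintro ω hω ⟨z, hz, hωz⟩
        obtain ⟨n, h2, h3⟩ := hω
        have h4 := S.mem_of_mem_outputIn h2 hωz
        simp only [Set.mem_singleton_iff] at h3 h4
        exact hy (h3 ▸ h4 ▸ hz)
    · rw [Set.indicator_of_notMem hyA]
      by_cases hy : y ∈ ruleReach β x
      · rw [Set.indicator_of_mem hy, outputIn_inter, Set.inter_singleton_eq_empty.2 hyA,
          outputIn_empty, measure_empty]
      · rw [Set.indicator_of_notMem hy]
  · intro y _ z _ hyz
    refine Set.disjoint_left.2 fun ω h2 h3 => hyz ?_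
    have : ω ∈ S.outputIn ({y} ∩ {z}) := by
      rw [← outputIn_inter]
      exact ⟨h2.2, h3.2⟩
    by_contra hyz
    rw [Set.singleton_inter_eq_empty.2 (by simpa using hyz), outputIn_empty] at this
    exact this
  · exact fun y _ => (S.measurableSet_outputIn x A).inter (S.measurableSet_outputIn x {y})

lemma tsum_outputProb (x : E) : ∑' y, S.outputProb x y = 1 := by
  have := S.isProbabilityMeasure x
  rw [← tsum_univ, ← S.law_outputIn_eq_tsum hβ, ← prob_compl_eq_zero_iff
    (S.measurableSet_outputIn x _)]
  refine measure_mono_null ?_ (ae_iff.1 (S.ae_mem_outputIn hβ x))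
  rintro ω hω ⟨y, -, n, h1, -⟩
  exact hω ⟨n, h1, trivial⟩

-- A run of the rule is a finite path of positive probability. Each earlier state has a successor,
-- so the chain is not stopped before the end of the path.
omit hβ in
lemma outputProb_pos {x y : E} (h : y ∈ ruleReach β x) (hy : β y = ∅) :
    0 < S.outputProb x y := by
  have := S.isProbabilityMeasure x
  have key : ∃ (n : ℕ) (z : ℕ → E), z n = y ∧ (∀ i < n, β (z i) ≠ ∅) ∧
      0 < S.law x {ω | ∀ i ≤ n, S.path i ω = z i} := by
    clear hy
    induction h with
    | refl =>
      refine ⟨0, fun _ => x, rfl, by simp, ?_⟩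
      have : S.law x {ω | ∀ i ≤ 0, S.path i ω = x} = 1 := by
        rw [← measure_univ (μ := S.law x)]
        refine measure_congr ?_
        filter_upwards [S.start x] with ω h
        exact propext ⟨fun _ => trivial, fun _ i hi => by rw [Nat.le_zero.1 hi, h]⟩
      rw [this]
      exact one_pos
    | @tail y y' _ h ih =>
      obtain ⟨n, z, rfl, h2, h3⟩ := ih
      have hne : β (z n) ≠ ∅ := (Set.nonempty_of_mem h).ne_empty
      set z' := Function.update z (n + 1) y' with hz'
      have hzz' : ∀ i ≤ n, z' i = z i := fun i hi => Function.update_of_ne (by omega) _ _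
      have hlast : z' (n + 1) = y' := Function.update_self _ _ _
      refine ⟨n + 1, z', hlast, fun i hi => ?_, ?_⟩
      · rw [hzz' i (by omega)]
        rcases Nat.lt_or_ge i n with h4 | h4
        · exact h2 i h4
        · rwa [show i = n by omega]
      · rw [(S.markov x).2 n z', hlast, hzz' n le_rfl]
        refine ENNReal.mul_pos ?_ ((S.step_pos_iff _ hne _).2 h).ne'
        have heq : {ω | ∀ i ≤ n, S.path i ω = z' i} = {ω | ∀ i ≤ n, S.path i ω = z i} :=
          Set.ext fun ω => forall₂_congr fun i hi => by rw [hzz' i hi]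
        exact heq ▸ h3.ne'
  obtain ⟨n, z, rfl, h2, h3⟩ := key
  refine h3.trans_le (measure_mono fun ω hω => ⟨n, ?_, hω n le_rfl⟩)
  rw [stoppingTime_eq_iff, hω n le_rfl]
  exact ⟨hy, fun m hm => by rw [hω m hm.le]; exact h2 m hm⟩

lemma outputProb_pos_iff {x y : E} :
    0 < S.outputProb x y ↔ y ∈ ruleReach β x ∧ β y = ∅ := by
  refine ⟨fun h => ?_, fun h => S.outputProb_pos h.1 h.2⟩
  obtain ⟨ω, h1, h2⟩ : ∃ ω ∈ S.outputIn {y}, ∀ n, S.path n ω ∈ ruleReach β x := by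
    by_contra! h'
    refine h.ne' (measure_mono_null (t := {ω | ¬ ∀ n, S.path n ω ∈ ruleReach β x}) ?_
      (ae_iff.1 (ae_all_iff.2 (S.ae_path_mem hβ x))))
    intro ω hω hall
    obtain ⟨n, hn⟩ := h' ω hω
    exact hn (hall n)
  obtain ⟨n, h3, rfl⟩ := h1
  exact ⟨h2 n, ((S.stoppingTime_eq_iff ω n).1 h3).1⟩

omit hβ in
lemma condOutputProb_eq (A : Set E) (x y : E) : S.condOutputProb A x y =
    (S.law x (S.outputIn A))⁻¹ * S.law x (S.outputIn (A ∩ {y})) := by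
  rw [condOutputProb, cond_apply (S.measurableSet_outputIn x A), outputIn_inter]

-- The inverse normalization is never zero. If the conditioning event is null it is infinite, but
-- the outputs in `A` are then null as well and the product vanishes.
omit hβ in
lemma condOutputProb_pos_iff {A : Set E} {x y : E} :
    0 < S.condOutputProb A x y ↔ y ∈ A ∧ 0 < S.outputProb x y := by
  have := S.isProbabilityMeasure x
  rw [condOutputProb_eq]
  by_cases hy : y ∈ A
  · rw [Set.inter_eq_right.2 (Set.singleton_subset_iff.2 hy)]
    simp only [pos_iff_ne_zero, ne_eq, mul_eq_zero, ENNReal.inv_eq_zero, measure_ne_top,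
      false_or, hy, true_and]
    rfl
  · simp [Set.inter_singleton_eq_empty.2 hy, outputIn_empty, hy]

lemma tsum_condOutputProb {A : Set E} {x : E} (h : 0 < S.law x (S.outputIn A)) :
    ∑' y : A, S.condOutputProb A x y = 1 := by
  have := S.isProbabilityMeasure x
  have h1 : ∀ y : A, S.condOutputProb A x y =
      (S.law x (S.outputIn A))⁻¹ * S.outputProb x y := fun y => by
    rw [condOutputProb_eq, Set.inter_eq_right.2 (Set.singleton_subset_iff.2 y.2)]
    rfl
  simp only [h1, ENNReal.tsum_mul_left, ← S.law_outputIn_eq_tsum hβ]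
  exact ENNReal.inv_mul_cancel h.ne' (measure_ne_top _ _)

end StoppedMarkovChain

/-! ### The split and merge process -/

lemma tsum_compKernel {E : Type*} {k l : E → E → ℝ≥0∞} {x : E} (hk : ∑' z, k x z = 1)
    (hl : ∀ z, 0 < k x z → ∑' y, l z y = 1) : ∑' y, compKernel k l x y = 1 := by
  unfold compKernel
  rw [ENNReal.tsum_comm, ← hk]
  refine tsum_congr fun z => ?_
  rw [ENNReal.tsum_mul_left]
  rcases eq_or_ne (k x z) 0 with h | h
  · rw [h, zero_mul]
  · rw [hl z (pos_iff_ne_zero.2 h), mul_one]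

/-- Observing a chain every other time. -/
lemma IsMarkovChain.everyOther {E Ω : Type*} [MeasurableSpace Ω] {μ : Measure Ω} {X : ℕ → Ω → E}
    {k : ℕ → E → E → ℝ≥0∞} (hX : IsMarkovChain μ X k) (r : ℕ) (q : E → E → ℝ≥0∞)
    (h : ∀ (t : ℕ) (A : ℕ → Set E) (x y : E),
      μ {ω | (∀ i < 2 * t + r, X i ω ∈ A i) ∧ X (2 * t + r) ω = x ∧ X (2 * t + r + 2) ω = y} =
        μ {ω | (∀ i < 2 * t + r, X i ω ∈ A i) ∧ X (2 * t + r) ω = x} * q x y) :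
    IsMarkovChain μ (fun t => X (2 * t + r)) (fun _ => q) := by
  refine ⟨fun t => hX.1 _, fun t x => ?_⟩
  -- The box fixes the past at the sampled times and leaves the other times free.
  have key := h t (fun i => {e | ∀ j, 2 * j + r = i → e = x j}) (x t) (x (t + 1))
  have hev : ∀ ω, ((∀ i < 2 * t + r, ∀ j, 2 * j + r = i → X i ω = x j) ∧
      X (2 * t + r) ω = x t) ↔ ∀ j ≤ t, X (2 * j + r) ω = x j := by
    intro ω
    constructor
    · rintro ⟨h1, h2⟩ j hj
      rcases hj.eq_or_lt with rfl | hj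
      · exact h2
      · exact h1 _ (by omega) j rfl
    · intro h1
      refine ⟨?_, h1 t le_rfl⟩
      rintro _ hi j rfl
      exact h1 j (by omega)
  have hidx : 2 * (t + 1) + r = 2 * t + r + 2 := by ring
  convert key using 3
  · ext ω
    simp only [Set.mem_ofPred_eq, ← and_assoc, hev]
    constructor
    · exact fun h1 => ⟨fun j hj => h1 j (by omega), hidx ▸ h1 (t + 1) le_rfl⟩
    · rintro ⟨h1, h2⟩ j hj
      rcases hj.eq_or_lt with rfl | hj
      · rwa [hidx]
      · exact h1 j (by omega)
  · ext ω
    exact (hev ω).symm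

/-- The grammars obtained by parsing texts. -/
def parsedGrammars (R : Grammar D) : Set (Grammar D) :=
  {g | ∃ T ∈ texts D, g ∈ ruleReach (narrowParse R) T ∧ narrowParse R g = ∅}

lemma isCharged_of_mem_parsedGrammars {R g : Grammar D} (hg : g ∈ parsedGrammars R) :
    IsCharged R g := by
  obtain ⟨T, hT, h, -⟩ := hg
  induction h with
  | refl => exact isCharged_of_mem_texts hT
  | tail _ h ih => exact ih.narrowParse h

lemma countable_parsedGrammars [Finite D] (R : Grammar D) : (parsedGrammars R).Countable :=
  ((countable_texts (D := D)).biUnion fun T _ =>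
    ((isTerminating_narrowParse R).finite_ruleReach T).countable).mono
      fun _ ⟨_, hT, h, _⟩ => Set.mem_biUnion hT h

section Kernels

variable {R : Grammar D} {Ω₁ : Type*} [MeasurableSpace Ω₁] (S : ParsingProcess R Ω₁)
  {Ω₂ : Type*} [MeasurableSpace Ω₂] (P : ProductionProcess D Ω₂)

lemma splitProb_pos_iff {T g : Grammar D} :
    0 < splitProb S T g ↔ g ∈ ruleReach (narrowParse R) T ∧ narrowParse R g = ∅ :=
  S.outputProb_pos_iff (isTerminating_narrowParse R)

lemma mergeProb_pos_iff {g T : Grammar D} :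
    0 < mergeProb P g T ↔ T ∈ texts D ∧ T ∈ ruleReach merge g := by
  rw [mergeProb, P.condOutputProb_pos_iff, P.outputProb_pos_iff isTerminating_merge]
  exact ⟨fun h => ⟨h.1, h.2.1⟩, fun h => ⟨h.1, h.2, merge_eq_empty_of_mem_texts h.1⟩⟩

lemma mem_parsedGrammars_of_splitProb_pos {T g : Grammar D} (hT : T ∈ texts D)
    (h : 0 < splitProb S T g) : g ∈ parsedGrammars R :=
  ⟨T, hT, (splitProb_pos_iff S).1 h⟩

/-- Reversing splits gives one direction; the other reorders the merges and uses that R charges the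
local expressions of `g`. Parsing stops at `g` because `g` is a parsed grammar. -/
lemma splitProb_pos_iff_mergeProb_pos {T g : Grammar D} (hT : T ∈ texts D)
    (hg : g ∈ parsedGrammars R) : 0 < splitProb S T g ↔ 0 < mergeProb P g T := by
  rw [splitProb_pos_iff, mergeProb_pos_iff]
  constructor
  · exact fun h => ⟨hT, merges_of_narrowParse h.1⟩
  · exact fun h => ⟨narrowParse_of_merges (isCharged_of_mem_parsedGrammars hg) h.2
      (isGlobal_of_mem_texts hT), hg.choose_spec.2.2⟩

lemma law_outputIn_texts_pos {g : Grammar D} (hg : g ∈ parsedGrammars R) :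
    0 < P.law g (P.outputIn (texts D)) := by
  obtain ⟨T, hT, h, -⟩ := hg
  refine (P.outputProb_pos (x := g) (y := T) (merges_of_narrowParse h)
    (merge_eq_empty_of_mem_texts hT)).trans_le (measure_mono ?_)
  rintro ω ⟨n, h1, h2⟩
  rw [Set.mem_singleton_iff] at h2
  exact ⟨n, h1, h2 ▸ hT⟩

lemma tsum_splitProb (g : Grammar D) : ∑' g', splitProb S g g' = 1 :=
  S.tsum_outputProb (isTerminating_narrowParse R) g

lemma tsum_texts_mergeProb {g : Grammar D} (hg : g ∈ parsedGrammars R) :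
    ∑' T : texts D, mergeProb P g T = 1 :=
  P.tsum_condOutputProb isTerminating_merge (law_outputIn_texts_pos P hg)

lemma tsum_mergeProb {g : Grammar D} (hg : g ∈ parsedGrammars R) :
    ∑' T, mergeProb P g T = 1 := by
  rw [← tsum_texts_mergeProb P hg]
  exact (tsum_subtype_eq_of_support_subset fun T hT =>
    ((mergeProb_pos_iff P).1 (pos_iff_ne_zero.2 hT)).1).symm

lemma communicationKernel_pos_iff {T T' : Grammar D} : 0 < communicationKernel S P T T' ↔
    ∃ g, 0 < splitProb S T g ∧ 0 < mergeProb P g T' := exists_pos_of_compKernel_pos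

lemma grammarKernel_pos_iff {g g' : Grammar D} : 0 < grammarKernel S P g g' ↔
    ∃ T, 0 < mergeProb P g T ∧ 0 < splitProb S T g' := exists_pos_of_compKernel_pos

lemma isClosedClass_texts : IsClosedClass (communicationKernel S P) (texts D) where
  mem_of_pos T hT T' h := by
    obtain ⟨g, -, h⟩ := (communicationKernel_pos_iff S P).1 h
    exact ((mergeProb_pos_iff P).1 h).1
  tsum_eq_one T hT := tsum_compKernel (tsum_splitProb S T) fun _ hg =>
    tsum_mergeProb P (mem_parsedGrammars_of_splitProb_pos S hT hg)

lemma communicationKernel_symm {T T' : Grammar D} (hT : T ∈ texts D) (hT' : T' ∈ texts D)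
    (h : 0 < communicationKernel S P T T') : 0 < communicationKernel S P T' T := by
  rw [communicationKernel_pos_iff] at h ⊢
  obtain ⟨g, h1, h2⟩ := h
  have hg := mem_parsedGrammars_of_splitProb_pos S hT h1
  exact ⟨g, (splitProb_pos_iff_mergeProb_pos S P hT' hg).2 h2,
    (splitProb_pos_iff_mergeProb_pos S P hT hg).1 h1⟩

lemma grammarKernel_symm {g g' : Grammar D} (hg : g ∈ parsedGrammars R)
    (hg' : g' ∈ parsedGrammars R)
    (h : 0 < grammarKernel S P g g') : 0 < grammarKernel S P g' g := by
  rw [grammarKernel_pos_iff] at h ⊢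
  obtain ⟨T, h1, h2⟩ := h
  have hT := ((mergeProb_pos_iff P).1 h1).1
  exact ⟨T, (splitProb_pos_iff_mergeProb_pos S P hT hg').1 h2,
    (splitProb_pos_iff_mergeProb_pos S P hT hg).2 h1⟩

lemma finite_reachable_communicationKernel [Finite D] {T : Grammar D} (hT : T ∈ texts D) :
    (reachable (communicationKernel S P) T).Finite := by
  obtain ⟨n, hn⟩ := exists_nat_ge (T.total numWord)
  refine (finite_texts_of_total_le (D := D) n).subset fun T' h => ?_
  rw [mem_reachable_iff] at h
  induction h with
  | refl => exact ⟨hT, hn⟩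
  | tail _ h ih =>
    obtain ⟨g, h1, h2⟩ := (communicationKernel_pos_iff S P).1 h
    obtain ⟨h3, h4⟩ := (mergeProb_pos_iff P).1 h2
    refine ⟨h3, ?_⟩
    rw [← total_numWord_of_merge h4,
      ← total_numWord_of_narrowParse ((splitProb_pos_iff S).1 h1).1]
    exact ih.2

/-- The start `g` is arbitrary, but every later state is parsed from a text with at most as many
words as `g`. -/
lemma finite_reachable_grammarKernel [Finite D] (g : Grammar D) :
    (reachable (grammarKernel S P) g).Finite := by
  obtain ⟨n, hn⟩ := exists_nat_ge (g.total numWord)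
  have hfin : ({g} ∪ ⋃ T ∈ {T ∈ texts D | T.total numWord ≤ n},
      ruleReach (narrowParse R) T).Finite :=
    (Set.finite_singleton g).union ((finite_texts_of_total_le (D := D) n).biUnion fun T _ =>
      (isTerminating_narrowParse R).finite_ruleReach T)
  suffices h : ∀ g' ∈ reachable (grammarKernel S P) g, g'.total numWord ≤ n ∧
      g' ∈ {g} ∪ ⋃ T ∈ {T ∈ texts D | T.total numWord ≤ n}, ruleReach (narrowParse R) T from
    hfin.subset fun g' hg' => (h g' hg').2
  intro g' h
  rw [mem_reachable_iff] at h
  induction h with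
  | refl => exact ⟨hn, .inl rfl⟩
  | tail _ h ih =>
    obtain ⟨T, h1, h2⟩ := (grammarKernel_pos_iff S P).1 h
    obtain ⟨h3, h4⟩ := (mergeProb_pos_iff P).1 h1
    have h5 := ((splitProb_pos_iff S).1 h2).1
    have hT : T.total numWord ≤ n := (total_numWord_of_merge h4) ▸ ih.1
    exact ⟨(total_numWord_of_narrowParse h5) ▸ hT, .inr (Set.mem_biUnion ⟨h3, hT⟩ h5)⟩

end Kernels

namespace IsSplitMergeProcess

variable {R : Grammar D} {Ω₁ : Type*} [MeasurableSpace Ω₁] {S : ParsingProcess R Ω₁}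
  {Ω₂ : Type*} [MeasurableSpace Ω₂] {P : ProductionProcess D Ω₂}
  {Ω : Type*} [MeasurableSpace Ω] {μ : Measure Ω} {G : ℕ → Ω → Grammar D}

/-- The states of the process at even and odd times. -/
def stateSet (R : Grammar D) (n : ℕ) : Set (Grammar D) :=
  if Even n then texts D else parsedGrammars R

lemma countable_stateSet [Finite D] (R : Grammar D) (n : ℕ) : (stateSet R n).Countable := by
  unfold stateSet
  split_ifs
  · exact countable_texts
  · exact countable_parsedGrammars R

lemma mem_stateSet_succ {n : ℕ} {g g' : Grammar D} (hg : g ∈ stateSet R n)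
    (h : (if Even n then splitProb S else mergeProb P) g g' ≠ 0) : g' ∈ stateSet R (n + 1) := by
  unfold stateSet at *
  by_cases hn : Even n
  · simp only [hn, if_true, Nat.even_add_one, not_true_eq_false, if_false] at *
    exact mem_parsedGrammars_of_splitProb_pos S hg (pos_iff_ne_zero.2 h)
  · simp only [hn, if_false, Nat.even_add_one, not_false_eq_true, if_true] at *
    exact ((mergeProb_pos_iff P).1 (pos_iff_ne_zero.2 h)).1

variable [Finite D] (hG : IsSplitMergeProcess S P μ G)
include hG

lemma ae_mem_stateSet (n : ℕ) : ∀ᵐ ω ∂μ, G n ω ∈ stateSet R n := by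
  have := hG.1
  refine hG.2.2.ae_mem (countable_stateSet R) (by simpa [stateSet] using hG.2.1) ?_ n
  intro n x hx
  rw [tsum_subtype_eq_of_support_subset fun y hy => mem_stateSet_succ hx hy]
  unfold stateSet at hx
  by_cases hn : Even n
  · simpa [hn] using tsum_splitProb S x
  · simp only [hn, if_false] at hx ⊢
    exact tsum_mergeProb P hx

lemma oddSupport_subset : oddSupport μ G ⊆ parsedGrammars R := by
  rintro g ⟨t, ht⟩
  by_contra h
  refine ht.ne' (measure_mono_null (t := {ω | ¬ G (2 * t + 1) ω ∈ stateSet R (2 * t + 1)}) ?_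
    (ae_iff.1 (hG.ae_mem_stateSet _)))
  rintro ω rfl
  simpa [stateSet] using h

/-- The sum over the countable state sets is the full composition when `x` is a possible state at
time `n`; for any other `x`, both sides are zero. -/
lemma measure_box_two (n : ℕ) (A : ℕ → Set (Grammar D)) (x y : Grammar D) :
    μ {ω | (∀ i < n, G i ω ∈ A i) ∧ G n ω = x ∧ G (n + 2) ω = y} =
      μ {ω | (∀ i < n, G i ω ∈ A i) ∧ G n ω = x} *
        compKernel (if Even n then splitProb S else mergeProb P)
          (if Even (n + 1) then splitProb S else mergeProb P) x y := by
  rw [hG.2.2.measure_box_two (Set.countable_iUnion (countable_stateSet R)) fun i => by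
    filter_upwards [hG.ae_mem_stateSet i] with ω h using Set.mem_iUnion.2 ⟨i, h⟩]
  by_cases hx : x ∈ stateSet R n
  · congr 1
    refine tsum_subtype_eq_of_support_subset (f := fun z =>
      (if Even n then splitProb S else mergeProb P) x z *
        (if Even (n + 1) then splitProb S else mergeProb P) z y) fun z hz => ?_
    exact Set.mem_iUnion.2 ⟨n + 1, mem_stateSet_succ hx (left_ne_zero_of_mul hz)⟩
  · have : μ {ω | (∀ i < n, G i ω ∈ A i) ∧ G n ω = x} = 0 := by
      refine measure_mono_null (t := {ω | ¬ G n ω ∈ stateSet R n}) ?_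
        (ae_iff.1 (hG.ae_mem_stateSet _))
      rintro ω ⟨-, rfl⟩
      exact hx
    rw [this, zero_mul, zero_mul]

lemma isMarkovChain_even :
    IsMarkovChain μ (fun t => G (2 * t)) (fun _ => communicationKernel S P) :=
  hG.2.2.everyOther 0 _ fun t A x y => by
    simpa [Nat.even_add_one, communicationKernel] using hG.measure_box_two (2 * t) A x y

lemma isMarkovChain_odd :
    IsMarkovChain μ (fun t => G (2 * t + 1)) (fun _ => grammarKernel S P) :=
  hG.2.2.everyOther 1 _ fun t A x y => by
    simpa [Nat.even_add_one, grammarKernel] using hG.measure_box_two (2 * t + 1) A x y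

lemma isClosedClass_oddSupport : IsClosedClass (grammarKernel S P) (oddSupport μ G) where
  mem_of_pos g hg g' h := by
    obtain ⟨t, ht⟩ := hg
    -- A state charged at time `2 * t + 1`, followed by a positive two-step transition, charges the
    -- target two time units later.
    refine ⟨t + 1, lt_of_lt_of_le (ENNReal.mul_pos ht.ne' h.ne') ?_⟩
    have := hG.measure_box_two (2 * t + 1) (fun _ => Set.univ) g g'
    simp only [Set.mem_univ, implies_true, true_and, Nat.even_add_one, even_two, Even.mul_right,
      not_true_eq_false, not_false_eq_true, if_true, if_false] at this
    exact this.symm.le.trans (measure_mono fun ω hω => hω.2)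
  tsum_eq_one g hg := tsum_compKernel (tsum_mergeProb P (hG.oddSupport_subset hg))
    fun T _ => tsum_splitProb S T

end IsSplitMergeProcess

end ToricGrammar

end

theorem mainTheorem1 {D : Type*} [Finite D] (R : Grammar D)
    {Ω₁ : Type*} [MeasurableSpace Ω₁] (S : ParsingProcess R Ω₁)
    {Ω₂ : Type*} [MeasurableSpace Ω₂] (P : ProductionProcess D Ω₂)
    {Ω : Type*} [MeasurableSpace Ω] (μ : Measure Ω) (G : ℕ → Ω → Grammar D)
    (hG : IsSplitMergeProcess S P μ G) :
    -- weak reversibility between texts and grammars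
    (∀ T ∈ texts D, ∀ g ∈ oddSupport μ G, 0 < splitProb S T g ↔ 0 < mergeProb P g T) ∧
    -- the conditioning on producing a text is legitimate
    (∀ g ∈ oddSupport μ G, 0 < P.law g (P.outputIn (texts D))) ∧
    -- the communication kernel is a Markov kernel on texts
    (∀ T ∈ texts D, ∑' T' : texts D, communicationKernel S P T T' = 1) ∧
    -- weak reversibility of the text chain and of the grammar chain
    (∀ T ∈ texts D, ∀ T' ∈ texts D,
      0 < communicationKernel S P T T' ↔ 0 < communicationKernel S P T' T) ∧
    (∀ g ∈ oddSupport μ G, ∀ g' ∈ oddSupport μ G,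
      0 < grammarKernel S P g g' ↔ 0 < grammarKernel S P g' g) ∧
    -- both are time homogeneous Markov chains
    IsMarkovChain μ (fun t => G (2 * t)) (fun _ => communicationKernel S P) ∧
    IsMarkovChain μ (fun t => G (2 * t + 1)) (fun _ => grammarKernel S P) ∧
    -- finite reachable sets
    (∀ T ∈ texts D, (reachable (communicationKernel S P) T).Finite) ∧
    (∀ g ∈ oddSupport μ G, (reachable (grammarKernel S P) g).Finite) ∧
    -- partition into finite positive recurrent communicating classes
    SplitsIntoFinitePositiveRecurrentClasses (communicationKernel S P) (texts D) ∧
    SplitsIntoFinitePositiveRecurrentClasses (grammarKernel S P) (oddSupport μ G) := by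
  have hsub := hG.oddSupport_subset
  have hsymm : ∀ T ∈ texts D, ∀ T' ∈ texts D,
      0 < communicationKernel S P T T' ↔ 0 < communicationKernel S P T' T := fun T hT T' hT' =>
    ⟨communicationKernel_symm S P hT hT', communicationKernel_symm S P hT' hT⟩
  have hsymm' : ∀ g ∈ oddSupport μ G, ∀ g' ∈ oddSupport μ G,
      0 < grammarKernel S P g g' ↔ 0 < grammarKernel S P g' g := fun g hg g' hg' =>
    ⟨grammarKernel_symm S P (hsub hg) (hsub hg'), grammarKernel_symm S P (hsub hg') (hsub hg)⟩
  refine ⟨fun T hT g hg => splitProb_pos_iff_mergeProb_pos S P hT (hsub hg),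
    fun g hg => law_outputIn_texts_pos P (hsub hg), fun T hT => ?_, hsymm, hsymm',
    hG.isMarkovChain_even, hG.isMarkovChain_odd,
    fun T hT => finite_reachable_communicationKernel S P hT,
    fun g _ => finite_reachable_grammarKernel S P g,
    splitsIntoFinitePositiveRecurrentClasses (isClosedClass_texts S P) hsymm
      fun T hT => finite_reachable_communicationKernel S P hT,
    splitsIntoFinitePositiveRecurrentClasses hG.isClosedClass_oddSupport hsymm'
      fun g _ => finite_reachable_grammarKernel S P g⟩
  rw [← (isClosedClass_texts S P).tsum_eq_one T hT]
  exact tsum_subtype_eq_of_support_subset fun T' hT' =>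
    (isClosedClass_texts S P).mem_of_pos T hT T' (pos_iff_ne_zero.2 hT')
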